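/- Let $n\ge 2$, $p\ge 0$ be integers and $\tilde c\in\mathbb R$. Let $(N^{n+p},\bar g)$ be a smooth Riemannian manifold of constant sectional curvature $\tilde c$ (a real space form), and let $(M^n,g)$ be an $n$-dimensional submanifold of $N$ with the induced metric, i.e. a Riemannian manifold with a smooth isometric immersion into $N$. Let $h$ be its second fundamental form (the normal part of the Levi-Civita derivative of $N$) and $A_\xi$ its shape operators, $g(A_\xi X,Y)=\bar g(h(X,Y),\xi)$. For $x\in M$ and an $l$-dimensional subspace $L\subseteq T_xM$ ($l\ge1$) with orthonormal basis $e_1,\dots,e_l$ put $$\mathcal C(L)=\frac1l\sum_{i,j=1}^{l}|h(e_i,e_j)|^2,\qquad \mathcal C_x=\mathcal C(T_xM),$$ $$[\hat\delta_c(n-1)]_x=2\,\mathcal C_x-\frac{2n-1}{2n}\,\sup\{\mathcal C(L)\mid L\subset T_xM \text{ a hyperplane}\},$$ and let $\rho=\frac{2}{n(n-1)}\sum_{1\le i<j\le n}K(e_i\wedge e_j)$ be the normalized scalar curvature of $(M,g)$, where $e_1,\dots,e_n$ is an orthonormal basis of $T_xM$ and $K$ is the sectional curvature of $(M,g)$.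 Then at every point of $M$ $$\rho\le\hat\delta_c(n-1)+\tilde c .$$ Moreover, equality holds at a point $x\in M$ if and only if, at $x$, the following hold: (i) $M$ is invariantly quasi-umbilical: there are $p$ mutually orthogonal unit normal vectors $\xi_{n+1},\dots,\xi_{n+p}$ such that each $A_{\xi_r}$ has an eigenvalue of multiplicity at least $n-1$, with the same distinguished eigendirection for all $r$ (there is a nonzero $e\in T_xM$ that is an eigenvector of every $A_{\xi_r}$, and every $A_{\xi_r}$ is a multiple of the identity on $e^\perp$); (ii) the normal connection is trivial: the curvature tensor $R^\perp$ of the normal connection $\nabla^\perp$ vanishes; (iii) for suitable orthonormal bases $e_1,\dots,e_n$ of $T_xM$ and $e_{n+1},\dots,e_{n+p}$ of the normal space, and some $\lambda\in\mathbb R$, the shape operators $A_r=A_{e_r}$ have the matrices $$A_{n+1}=\operatorname{diag}(2\lambda,\dots,2\lambda,\lambda),\qquad A_{n+2}=\dots=A_{n+p}=0$$ (for $p=0$ conditions on the $A_r$ are void). In particular, equality holds at all points of $M$ if and only if $M$ is an invariantly quasi-umbilical submanifold with trivial normal connection whose shape operators take the form (iii) at every point. -/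

import Mathlib

open scoped Manifold ContDiff Topology

set_option maxSynthPendingDepth 3

noncomputable section

namespace Casorati

/-! ### Riemannian geometry in a coordinate domain

A metric on (an open part of) a vector space `F` is a field `G` of bilinear forms, and a
parametrized submanifold is a map `f : E → F`. Vectors of `E` double as coordinate vector
fields, which commute. -/

section Coordinates

variable {E F : Type*} [NormedAddCommGroup E] [NormedSpace ℝ E]
  [NormedAddCommGroup F] [NormedSpace ℝ F]

/-- The trilinear form `(u, v, w) ↦ T(w, u, v)`. -/
def rotate (T : F →L[ℝ] F →L[ℝ] F →L[ℝ] ℝ) : F →L[ℝ] F →L[ℝ] F →L[ℝ] ℝ :=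
  (ContinuousLinearMap.flipₗᵢ ℝ F F ℝ : (F →L[ℝ] F →L[ℝ] ℝ) →L[ℝ] (F →L[ℝ] F →L[ℝ] ℝ)) ∘L T.flip

/-- Christoffel symbols of the first kind:
`(u, v, w) ↦ (∂_u G(v, w) + ∂_v G(u, w) - ∂_w G(u, v)) / 2`. -/
def christoffelFirst (G : F → F →L[ℝ] F →L[ℝ] ℝ) (y : F) : F →L[ℝ] F →L[ℝ] F →L[ℝ] ℝ :=
  (1 / 2 : ℝ) • (fderiv ℝ G y + (fderiv ℝ G y).flip - rotate (fderiv ℝ G y))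

theorem christoffelFirst_apply (G : F → F →L[ℝ] F →L[ℝ] ℝ) (y u v w : F) :
    christoffelFirst G y u v w =
      (1 / 2) * (fderiv ℝ G y u v w + fderiv ℝ G y v u w - fderiv ℝ G y w u v) := by
  simp [christoffelFirst, rotate]

/-- Christoffel symbols `Γ(u, v)` of the Levi-Civita connection of `G` (the last index raised
with the inverse of the metric). -/
def christoffel (G : F → F →L[ℝ] F →L[ℝ] ℝ) (y : F) : F →L[ℝ] F →L[ℝ] F :=
  ContinuousLinearMap.compL ℝ F (F →L[ℝ] ℝ) F (G y).inverse ∘L christoffelFirst G y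

/-- Levi-Civita covariant derivative, in the coordinate direction `u`, of a vector field `W`
along the map `f`: `DW(u) + Γ(df u, W)`. -/
def covDerivAlong (G : F → F →L[ℝ] F →L[ℝ] ℝ) (f : E → F) (u : E) (W : E → F) (y : E) : F :=
  fderiv ℝ W y u + christoffel G (f y) (fderiv ℝ f y u) (W y)

/-- Riemann curvature `R(u, v) w = ∇_u ∇_v w - ∇_v ∇_u w` of `G`, for coordinate vector fields. -/
def riemannCoord (G : F → F →L[ℝ] F →L[ℝ] ℝ) (y u v w : F) : F :=
  covDerivAlong G id u (covDerivAlong G id v (fun _ => w)) y -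
    covDerivAlong G id v (covDerivAlong G id u (fun _ => w)) y

/-- The metric induced by `f`: `(u, v) ↦ G(df u, df v)`. -/
def inducedMetric (G : F → F →L[ℝ] F →L[ℝ] ℝ) (f : E → F) (y : E) : E →L[ℝ] E →L[ℝ] ℝ :=
  (G (f y)).bilinearComp (fderiv ℝ f y) (fderiv ℝ f y)

/-- For `w` in the ambient space, the vector `t` with `(f^*G)(t, v) = G(w, df v)` for all `v`:
then `df t` is the tangential part of `w`. -/
def tangentialPart (G : F → F →L[ℝ] F →L[ℝ] ℝ) (f : E → F) (y : E) : F →L[ℝ] E :=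
  (inducedMetric G f y).inverse ∘L
    ((ContinuousLinearMap.compL ℝ E F ℝ).flip (fderiv ℝ f y) ∘L G (f y))

/-- Orthogonal projection onto the normal space of `f` at `y`. -/
def normalPart (G : F → F →L[ℝ] F →L[ℝ] ℝ) (f : E → F) (y : E) : F →L[ℝ] F :=
  ContinuousLinearMap.id ℝ F - fderiv ℝ f y ∘L tangentialPart G f y

/-- Second fundamental form: the normal part of the ambient covariant derivative
`D²f(u, v) + Γ(df u, df v)` of the coordinate field `df v` in the direction `u`. -/
def secondFundCoord (G : F → F →L[ℝ] F →L[ℝ] ℝ) (f : E → F) (y : E) : E →L[ℝ] E →L[ℝ] F :=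
  ContinuousLinearMap.compL ℝ E F F (normalPart G f y) ∘L
    (fderiv ℝ (fderiv ℝ f) y +
      (christoffel G (f y)).bilinearComp (fderiv ℝ f y) (fderiv ℝ f y))

/-- Shape operator in the direction `ξ`: `g(A_ξ u, v) = G(h(u, v), ξ)`. -/
def shapeCoord (G : F → F →L[ℝ] F →L[ℝ] ℝ) (f : E → F) (y : E) (ξ : F) : E →L[ℝ] E :=
  (inducedMetric G f y).inverse ∘L
    (ContinuousLinearMap.compL ℝ E F ℝ ((G (f y)).flip ξ) ∘L secondFundCoord G f y)

/-- Normal connection: the normal part of the ambient covariant derivative. -/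
def normalConnCoord (G : F → F →L[ℝ] F →L[ℝ] ℝ) (f : E → F) (u : E) (ξ : E → F) (y : E) : F :=
  normalPart G f y (covDerivAlong G f u ξ y)

/-- Curvature of the normal connection, `R^⊥(u, v) ξ = ∇^⊥_u ∇^⊥_v ξ - ∇^⊥_v ∇^⊥_u ξ`, for
coordinate vector fields `u, v` and a normal field `ξ`. -/
def normalCurvCoord (G : F → F →L[ℝ] F →L[ℝ] ℝ) (f : E → F) (u v : E) (ξ : E → F) (y : E) : F :=
  normalConnCoord G f u (normalConnCoord G f v ξ) y -
    normalConnCoord G f v (normalConnCoord G f u ξ) y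

/-- The normal curvature tensor vanishes at `y`: it kills every smooth local normal field. -/
def NormalFlatCoord (G : F → F →L[ℝ] F →L[ℝ] ℝ) (f : E → F) (y : E) : Prop :=
  ∀ ξ : E → F, ContDiffAt ℝ ∞ ξ y → (∀ᶠ z in 𝓝 y, ∀ u, G (f z) (fderiv ℝ f z u) (ξ z) = 0) →
    ∀ u v, normalCurvCoord G f u v ξ y = 0

end Coordinates

/-! ### Orthonormal frames of a subspace -/

section Frames

variable {V : Type*} [AddCommGroup V] [Module ℝ V]

/-- `e` is orthonormal for the bilinear form `B`. -/
def IsOrthonormal (B : V → V → ℝ) {ι : Type*} [DecidableEq ι] (e : ι → V) : Prop :=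
  ∀ i j, B (e i) (e j) = if i = j then 1 else 0

theorem exists_orthonormal [FiniteDimensional ℝ V] (B : V →ₗ[ℝ] V →ₗ[ℝ] ℝ)
    (hs : ∀ v w, B v w = B w v) (hp : ∀ v, v ≠ 0 → 0 < B v v) (L : Submodule ℝ V) :
    ∃ e : Fin (Module.finrank ℝ L) → V,
      IsOrthonormal (fun v w => B v w) e ∧ Submodule.span ℝ (Set.range e) = L := by
  let core : InnerProductSpace.Core ℝ L :=
    { inner := fun v w => B v w
      conj_inner_symm := fun v w => by simp [hs (w : V) v]
      re_inner_nonneg := fun v => by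
        by_cases h : (v : V) = 0
        · simp [h]
        · simpa using (hp v h).le
      add_left := fun u v w => by simp
      smul_left := fun u v r => by simp
      definite := fun v h => by
        by_contra hv
        exact (hp v (by simpa using hv)).ne' h }
  let _ : NormedAddCommGroup L := core.toNormedAddCommGroup
  let _ : InnerProductSpace ℝ L := InnerProductSpace.ofCore core.toCore
  let b := stdOrthonormalBasis ℝ L
  refine ⟨fun i => (b i : V), fun i j => ?_, ?_⟩
  · exact orthonormal_iff_ite.1 b.orthonormal i j
  · have h1 : Set.range (fun i => (b i : V)) = L.subtype '' Set.range b := by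
      rw [← Set.range_comp]; rfl
    have h2 : Submodule.span ℝ (Set.range b) = ⊤ := by
      rw [← b.coe_toBasis]; exact b.toBasis.span_eq
    rw [h1, Submodule.span_image, h2, Submodule.map_top, Submodule.range_subtype]

end Frames

/-! ### Riemannian manifolds -/

section Manifolds

/-- Smooth Riemannian metrics on an `m`-dimensional manifold. -/
abbrev Metric (m : ℕ) (M : Type*) [TopologicalSpace M] [ChartedSpace (EuclideanSpace ℝ (Fin m)) M]
    [IsManifold (𝓡 m) ∞ M] :=
  Bundle.ContMDiffRiemannianMetric (𝓡 m) ∞ (EuclideanSpace ℝ (Fin m))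
    (fun x : M => TangentSpace (𝓡 m) x)

variable {m : ℕ} {M : Type*} [TopologicalSpace M] [ChartedSpace (EuclideanSpace ℝ (Fin m)) M]
  [IsManifold (𝓡 m) ∞ M]

/-- The metric `g` in the preferred chart around `x`. The tangent space `TangentSpace (𝓡 m) x` is
the model space, identified through this same chart. -/
def chartMetric (g : Metric m M) (x : M) (y : EuclideanSpace ℝ (Fin m)) :
    EuclideanSpace ℝ (Fin m) →L[ℝ] EuclideanSpace ℝ (Fin m) →L[ℝ] ℝ :=
  ContinuousLinearMap.bilinearComp
    (E := EuclideanSpace ℝ (Fin m)) (F := EuclideanSpace ℝ (Fin m))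
    (g.inner ((extChartAt (𝓡 m) x).symm y))
    (mfderiv (𝓡 m) (𝓡 m) (extChartAt (𝓡 m) x).symm y)
    (mfderiv (𝓡 m) (𝓡 m) (extChartAt (𝓡 m) x).symm y)

theorem chartMetric_apply (g : Metric m M) (x : M) (y u v : EuclideanSpace ℝ (Fin m)) :
    chartMetric g x y u v = g.inner ((extChartAt (𝓡 m) x).symm y)
      (mfderiv (𝓡 m) (𝓡 m) (extChartAt (𝓡 m) x).symm y u)
      (mfderiv (𝓡 m) (𝓡 m) (extChartAt (𝓡 m) x).symm y v) := rfl

/-- Riemann curvature tensor of `(M, g)` at `x`, computed in the preferred chart around `x`. -/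
def riemann (g : Metric m M) (x : M) (u v w : TangentSpace (𝓡 m) x) : TangentSpace (𝓡 m) x :=
  riemannCoord (F := EuclideanSpace ℝ (Fin m)) (chartMetric g x) (extChartAt (𝓡 m) x x) u v w

/-- Sectional curvature of the plane spanned by `u` and `v`. -/
def sectionalCurvature (g : Metric m M) (x : M) (u v : TangentSpace (𝓡 m) x) : ℝ :=
  g.inner x (riemann g x u v v) u /
    (g.inner x u u * g.inner x v v - g.inner x u v ^ 2)

/-- `(M, g)` is a real space form of constant sectional curvature `c`. -/
def IsRealSpaceForm (g : Metric m M) (c : ℝ) : Prop :=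
  ∀ (x : M) (u v : TangentSpace (𝓡 m) x), LinearIndependent ℝ ![u, v] →
    sectionalCurvature g x u v = c

/-- Subspaces of the tangent space have orthonormal bases. -/
theorem exists_frame (g : Metric m M) (x : M) (L : Submodule ℝ (TangentSpace (𝓡 m) x)) :
    ∃ e : Fin (Module.finrank ℝ L) → TangentSpace (𝓡 m) x,
      IsOrthonormal (fun v w => g.inner x v w) e ∧ Submodule.span ℝ (Set.range e) = L := by
  have : FiniteDimensional ℝ (TangentSpace (𝓡 m) x) :=
    inferInstanceAs (FiniteDimensional ℝ (EuclideanSpace ℝ (Fin m)))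
  exact exists_orthonormal
    (LinearMap.mk₂ ℝ (fun v w => g.inner x v w) (by simp) (by simp) (by simp) (by simp))
    (fun v w => g.symm x v w) (fun v hv => g.pos x v hv) L

/-- Some orthonormal basis of `L`; the quantities defined with it do not depend on the choice. -/
def frame (g : Metric m M) (x : M) (L : Submodule ℝ (TangentSpace (𝓡 m) x)) :
    Fin (Module.finrank ℝ L) → TangentSpace (𝓡 m) x :=
  (exists_frame g x L).choose

/-- Scalar curvature `τ = ∑_{i < j} K(e_i ∧ e_j)`. -/
def scalarCurvature (g : Metric m M) (x : M) : ℝ :=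
  ∑ i, ∑ j, if i < j then sectionalCurvature g x (frame g x ⊤ i) (frame g x ⊤ j) else 0

/-- Normalized scalar curvature `ρ = 2 τ / (n (n - 1))`. -/
def normalizedScalarCurvature (g : Metric m M) (x : M) : ℝ :=
  2 * scalarCurvature g x / ((m : ℝ) * (m - 1))

end Manifolds

/-! ### Submanifolds -/

section Submanifolds

variable {n d : ℕ}
  {M : Type*} [TopologicalSpace M] [ChartedSpace (EuclideanSpace ℝ (Fin n)) M]
  [IsManifold (𝓡 n) ∞ M]
  {N : Type*} [TopologicalSpace N] [ChartedSpace (EuclideanSpace ℝ (Fin d)) N]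
  [IsManifold (𝓡 d) ∞ N]

/-- `φ` is a smooth isometric immersion, i.e. `M` is a submanifold of `N` with the induced
metric (positivity of `g` makes the differential injective). -/
structure IsIsometricImmersion (g : Metric n M) (gN : Metric d N) (φ : M → N) : Prop where
  contMDiff : ContMDiff (𝓡 n) (𝓡 d) ∞ φ
  isometric : ∀ (x : M) (u v : TangentSpace (𝓡 n) x),
    gN.inner (φ x) (mfderiv (𝓡 n) (𝓡 d) φ x u) (mfderiv (𝓡 n) (𝓡 d) φ x v) = g.inner x u v

/-- Second fundamental form of `φ` at `x`, computed in the preferred charts around `x`, `φ x`. -/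
def secondFund (gN : Metric d N) (φ : M → N) (x : M) (u v : TangentSpace (𝓡 n) x) :
    TangentSpace (𝓡 d) (φ x) :=
  secondFundCoord (chartMetric gN (φ x)) (writtenInExtChartAt (𝓡 n) (𝓡 d) x φ)
    (extChartAt (𝓡 n) x x) u v

/-- Shape operator `A_ξ` of `φ` at `x`. -/
def shapeOperator (gN : Metric d N) (φ : M → N) (x : M) (ξ : TangentSpace (𝓡 d) (φ x))
    (u : TangentSpace (𝓡 n) x) : TangentSpace (𝓡 n) x :=
  shapeCoord (chartMetric gN (φ x)) (writtenInExtChartAt (𝓡 n) (𝓡 d) x φ)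
    (extChartAt (𝓡 n) x x) ξ u

/-- The normal curvature tensor of `φ` vanishes at `x`. -/
def NormalFlatAt (gN : Metric d N) (φ : M → N) (x : M) : Prop :=
  NormalFlatCoord (chartMetric gN (φ x)) (writtenInExtChartAt (𝓡 n) (𝓡 d) x φ)
    (extChartAt (𝓡 n) x x)

/-- The normal connection of `φ` is trivial: its curvature tensor vanishes. -/
def TrivialNormalConnection (gN : Metric d N) (φ : M → N) : Prop :=
  ∀ x : M, NormalFlatAt (n := n) gN φ x

/-- Casorati curvature of the subspace `L` of the tangent space at `x`:
`C(L) = (1 / dim L) ∑_{i, j} |h(e_i, e_j)|²`. -/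
def casoratiOn (g : Metric n M) (gN : Metric d N) (φ : M → N) (x : M)
    (L : Submodule ℝ (TangentSpace (𝓡 n) x)) : ℝ :=
  (1 / (Module.finrank ℝ L : ℝ)) * ∑ i, ∑ j,
    gN.inner (φ x) (secondFund gN φ x (frame g x L i) (frame g x L j))
      (secondFund gN φ x (frame g x L i) (frame g x L j))

/-- Casorati curvature of the submanifold at `x`. -/
def casorati (g : Metric n M) (gN : Metric d N) (φ : M → N) (x : M) : ℝ :=
  casoratiOn g gN φ x ⊤

/-- Normalized Casorati curvature
`2 C - ((2 n - 1) / (2 n)) sup {C(L) | L a hyperplane of T_x M}`. -/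
def deltaHat (g : Metric n M) (gN : Metric d N) (φ : M → N) (x : M) : ℝ :=
  2 * casorati g gN φ x - ((2 * n - 1) / (2 * n) : ℝ) *
    sSup {C : ℝ | ∃ L : Submodule ℝ (TangentSpace (𝓡 n) x),
      Module.finrank ℝ L + 1 = n ∧ C = casoratiOn g gN φ x L}

/-- `ξ` is an orthonormal family of vectors normal to the submanifold at `x`. -/
def IsNormalFrame (gN : Metric d N) (φ : M → N) (x : M) {p : ℕ}
    (ξ : Fin p → TangentSpace (𝓡 d) (φ x)) : Prop :=
  IsOrthonormal (fun v w => gN.inner (φ x) v w) ξ ∧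
    ∀ (r : Fin p) (u : TangentSpace (𝓡 n) x),
      gN.inner (φ x) (mfderiv (𝓡 n) (𝓡 d) φ x u) (ξ r) = 0

/-- Invariantly quasi-umbilical at `x` (codimension `p`): for some `p` orthonormal normal vectors,
each shape operator has an eigenvalue `a` of multiplicity at least `n - 1`, whose eigenspace
contains the orthogonal complement of a common eigendirection `e`. -/
def InvariantlyQuasiUmbilicalAt (p : ℕ) (g : Metric n M) (gN : Metric d N) (φ : M → N)
    (x : M) : Prop :=
  ∃ ξ : Fin p → TangentSpace (𝓡 d) (φ x), IsNormalFrame (n := n) gN φ x ξ ∧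
    ∃ e : TangentSpace (𝓡 n) x, e ≠ 0 ∧ ∀ r, ∃ a b : ℝ,
      shapeOperator gN φ x (ξ r) e = b • e ∧
      ∀ v : TangentSpace (𝓡 n) x, g.inner x v e = 0 → shapeOperator gN φ x (ξ r) v = a • v

/-- Invariantly quasi-umbilical submanifolds. -/
def InvariantlyQuasiUmbilical (p : ℕ) (g : Metric n M) (gN : Metric d N) (φ : M → N) : Prop :=
  ∀ x : M, InvariantlyQuasiUmbilicalAt p g gN φ x

/-- The matrix of the shape operator `A_ξ` in the orthonormal frame `e`. -/
def shapeMatrix (g : Metric n M) (gN : Metric d N) (φ : M → N) (x : M)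
    (e : Fin n → TangentSpace (𝓡 n) x) (ξ : TangentSpace (𝓡 d) (φ x)) :
    Matrix (Fin n) (Fin n) ℝ :=
  Matrix.of fun i j => g.inner x (shapeOperator gN φ x ξ (e j)) (e i)

/-- In suitable orthonormal tangent and normal frames at `x`, the first shape operator is
`diag(2λ, …, 2λ, λ)` and the others vanish. -/
def IdealShapeAt (p : ℕ) (g : Metric n M) (gN : Metric d N) (φ : M → N) (x : M) : Prop :=
  ∃ (e : Fin n → TangentSpace (𝓡 n) x) (ξ : Fin p → TangentSpace (𝓡 d) (φ x)) (lam : ℝ),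
    IsOrthonormal (fun v w => g.inner x v w) e ∧ IsNormalFrame (n := n) gN φ x ξ ∧
    ∀ r : Fin p, shapeMatrix g gN φ x e (ξ r) =
      if (r : ℕ) = 0 then
        Matrix.diagonal (fun i : Fin n => if (i : ℕ) + 1 = n then lam else 2 * lam)
      else 0

end Submanifolds

end Casorati

end

/-! The Gauss equation reduces the inequality to linear algebra at one point. Let T be the trace of
h, S = |h|², and Q_ν the squared norm of h on the hyperplane orthogonal to a unit vector ν. In a
space form n(n-1)ρ = n(n-1)c + |T|² - S, so n(n-1)(δ̂ + c - ρ) = (2n-1)(S - Q/2) - |T|² with Q =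
max_ν Q_ν.

In an orthonormal basis ending in ν, S - Q_ν/2 = ½∑|h_ij|² + 2∑|h_iν|² + |h_νν|², where i, j run
over the hyperplane. Cauchy-Schwarz on the diagonal, with weights ½ (n-1 times) and 1, gives |T|² ≤
(2n-1)(S - Q_ν/2) for every ν. Equality forces h_ij = 2δ_ij t, h_iν = 0, h_νν = t, that is, h(u,v) =
(2g(u,v) - g(u,ν)g(v,ν)) t. Conversely, for such an h the hyperplane orthogonal to the distinguished
direction realizes the maximum, and equality holds.

This frame-free shape, `IsIdealForm`, is the pivot of the equality case. It is equivalent to (iii)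
after choosing adapted frames; (i) is read off from its shape operators, and (ii) follows from the
Ricci equation. The main lemmas are `IsImmersionNear.gauss`, `IsImmersionNear.ricci`,
`sumSq_sub_eq_sum_sq`, `IsInnerForm.trace_sq_le` and `IsInnerForm.trace_sq_eq_of_quasiUmbilical`. -/

noncomputable section

namespace Casorati

/-! ### Levi-Civita connection and curvature symmetries in coordinates. -/

section Coordinates

variable {E F : Type*} [NormedAddCommGroup E] [NormedSpace ℝ E]
  [NormedAddCommGroup F] [NormedSpace ℝ F]

/-- `G` is a `C²` field of bilinear forms near `y`, symmetric and positive definite there. -/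
structure IsMetricNear (G : F → F →L[ℝ] F →L[ℝ] ℝ) (y : F) : Prop where
  contDiffAt : ContDiffAt ℝ 2 G y
  symm : ∀ᶠ z in 𝓝 y, ∀ u v, G z u v = G z v u
  pos : ∀ᶠ z in 𝓝 y, ∀ u, u ≠ 0 → 0 < G z u u

theorem IsMetricNear.eventually {G : F → F →L[ℝ] F →L[ℝ] ℝ} {y : F} (h : IsMetricNear G y) :
    ∀ᶠ z in 𝓝 y, IsMetricNear G z := by
  filter_upwards [h.contDiffAt.eventually (by simp), h.symm.eventually_nhds,
    h.pos.eventually_nhds] with z h1 h2 h3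
  exact ⟨h1, h2, h3⟩

theorem IsMetricNear.differentiableAt {G : F → F →L[ℝ] F →L[ℝ] ℝ} {y : F} (h : IsMetricNear G y) :
    DifferentiableAt ℝ G y :=
  h.contDiffAt.differentiableAt (by simp)

theorem IsMetricNear.fderiv_symm {G : F → F →L[ℝ] F →L[ℝ] ℝ} {y : F} (h : IsMetricNear G y)
    (u v w : F) :
    fderiv ℝ G y u v w = fderiv ℝ G y u w v := by
  have h1 : ∀ v w : F, fderiv ℝ (fun z => G z v w) y u = fderiv ℝ G y u v w := by
    intro v w
    have := ((h.differentiableAt.hasFDerivAt.clm_apply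
      (hasFDerivAt_const v y)).clm_apply (hasFDerivAt_const w y)).fderiv
    rw [this]; simp
  rw [← h1, ← h1]
  congr 1
  apply Filter.EventuallyEq.fderiv_eq
  filter_upwards [h.symm] with z hz
  exact hz v w

/-- Indices are raised with `ContinuousLinearMap.inverse`, which is zero on non-invertible maps. A
definite form has trivial kernel, and a space and its dual have equal dimension, so the inverse is
genuine. -/
theorem isInvertible_of_pos [FiniteDimensional ℝ F] {B : F →L[ℝ] F →L[ℝ] ℝ}
    (hB : ∀ u, u ≠ 0 → 0 < B u u) : B.IsInvertible := by
  have hinj : Function.Injective (B : F →ₗ[ℝ] F →L[ℝ] ℝ) := by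
    rw [← LinearMap.ker_eq_bot, LinearMap.ker_eq_bot']
    intro u hu
    by_contra hne
    have := hB u hne
    have h2 : B u = 0 := hu
    simp [h2] at this
  have hd : Module.finrank ℝ F = Module.finrank ℝ (F →L[ℝ] ℝ) := by
    rw [← (LinearMap.toContinuousLinearMap : (F →ₗ[ℝ] ℝ) ≃ₗ[ℝ] F →L[ℝ] ℝ).finrank_eq]
    exact (Subspace.dual_finrank_eq (K := ℝ) (V := F)).symm
  refine ⟨(LinearEquiv.ofInjectiveOfFinrankEq _ hinj hd).toContinuousLinearEquiv, ?_⟩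
  ext u v
  rfl

theorem riemannCoord_antisymm (G : F → F →L[ℝ] F →L[ℝ] ℝ) (y u v w : F) :
    riemannCoord G y u v w = - riemannCoord G y v u w := by
  simp [riemannCoord]

section Metric

variable [FiniteDimensional ℝ F] {G : F → F →L[ℝ] F →L[ℝ] ℝ} {y : F}

theorem IsMetricNear.isInvertible (h : IsMetricNear G y) : (G y).IsInvertible :=
  isInvertible_of_pos h.pos.self_of_nhds

theorem IsMetricNear.eq_of_forall (h : IsMetricNear G y) {a b : F}
    (hab : ∀ w, G y a w = G y b w) : a = b :=
  h.isInvertible.injective (by ext w; exact hab w)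

theorem IsMetricNear.inner_christoffel (h : IsMetricNear G y) (u v w : F) :
    G y (christoffel G y u v) w = christoffelFirst G y u v w := by
  have := h.isInvertible.self_apply_inverse (christoffelFirst G y u v)
  exact congrArg (fun α : F →L[ℝ] ℝ => α w) this

theorem IsMetricNear.christoffel_symm (h : IsMetricNear G y) (u v : F) :
    christoffel G y u v = christoffel G y v u := by
  apply h.eq_of_forall
  intro w
  rw [h.inner_christoffel, h.inner_christoffel, christoffelFirst_apply, christoffelFirst_apply,
    h.fderiv_symm w u v]
  ring

/-- The Levi-Civita connection is metric. -/
theorem IsMetricNear.fderiv_eq (h : IsMetricNear G y) (u v w : F) :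
    fderiv ℝ G y u v w = G y (christoffel G y u v) w + G y v (christoffel G y u w) := by
  rw [h.symm.self_of_nhds v, h.inner_christoffel, h.inner_christoffel, christoffelFirst_apply,
    christoffelFirst_apply, h.fderiv_symm u w v, h.fderiv_symm w u v, h.fderiv_symm v u w]
  ring

theorem IsMetricNear.contDiffAt_christoffel (h : IsMetricNear G y) :
    ContDiffAt ℝ 1 (christoffel G) y := by
  have h1 : ContDiffAt ℝ 1 (fderiv ℝ G) y := h.contDiffAt.fderiv_right (by norm_num)
  have h2 : ContDiffAt ℝ 1 (fun z => (G z).inverse) y :=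
    (h.isInvertible.contDiffAt_map_inverse).comp y (h.contDiffAt.of_le (by norm_num))
  have h3 : ContDiffAt ℝ 1 (christoffelFirst G) y := by
    unfold christoffelFirst rotate
    refine (ContDiffAt.sub (h1.add ?_) ?_).const_smul (1 / 2 : ℝ)
    · exact (ContinuousLinearMap.flipₗᵢ ℝ F F (F →L[ℝ] ℝ)).contDiff.contDiffAt.comp y h1
    · exact contDiffAt_const.clm_comp
        ((ContinuousLinearMap.flipₗᵢ ℝ F F (F →L[ℝ] ℝ)).contDiff.contDiffAt.comp y h1)
  exact ((ContinuousLinearMap.compL ℝ F (F →L[ℝ] ℝ) F).contDiff.contDiffAt.comp y h2).clm_comp h3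

end Metric

section CovDeriv

variable {G : F → F →L[ℝ] F →L[ℝ] ℝ} {f : E → F} {y : E}

theorem fderiv_covDerivAlong (hΓ : DifferentiableAt ℝ (christoffel G) (f y))
    (hf : ContDiffAt ℝ 2 f y) {W : E → F} (hW : ContDiffAt ℝ 2 W y) (v : E) :
    DifferentiableAt ℝ (covDerivAlong G f v W) y ∧ ∀ u,
    fderiv ℝ (covDerivAlong G f v W) y u = fderiv ℝ (fderiv ℝ W) y u v +
      (fderiv ℝ (christoffel G) (f y) (fderiv ℝ f y u) (fderiv ℝ f y v) (W y) +
        christoffel G (f y) (fderiv ℝ (fderiv ℝ f) y u v) (W y) +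
        christoffel G (f y) (fderiv ℝ f y v) (fderiv ℝ W y u)) := by
  have hf1 : DifferentiableAt ℝ (fderiv ℝ f) y :=
    (hf.fderiv_right (m := 1) (by norm_num)).differentiableAt (by simp)
  have hW1 : DifferentiableAt ℝ (fderiv ℝ W) y :=
    (hW.fderiv_right (m := 1) (by norm_num)).differentiableAt (by simp)
  have hf0 : DifferentiableAt ℝ f y := hf.differentiableAt (by simp)
  have hW0 : DifferentiableAt ℝ W y := hW.differentiableAt (by simp)
  have hc : HasFDerivAt (fun z => christoffel G (f z)) _ y :=
    hΓ.hasFDerivAt.comp y hf0.hasFDerivAt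
  have key := (hW1.hasFDerivAt.clm_apply (hasFDerivAt_const v y)).add
    ((hc.clm_apply (hf1.hasFDerivAt.clm_apply (hasFDerivAt_const v y))).clm_apply hW0.hasFDerivAt)
  refine ⟨key.differentiableAt, fun u => ?_⟩
  have h2 : fderiv ℝ (covDerivAlong G f v W) y = _ := key.fderiv
  rw [h2]
  simp
  abel

/-- Second covariant derivatives along a map commute up to the curvature of the connection. -/
theorem covDerivAlong_comm (hΓ : DifferentiableAt ℝ (christoffel G) (f y))
    (hf : ContDiffAt ℝ 2 f y) {W : E → F} (hW : ContDiffAt ℝ 2 W y) (u v : E) :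
    covDerivAlong G f u (covDerivAlong G f v W) y - covDerivAlong G f v (covDerivAlong G f u W) y =
      fderiv ℝ (christoffel G) (f y) (fderiv ℝ f y u) (fderiv ℝ f y v) (W y) -
      fderiv ℝ (christoffel G) (f y) (fderiv ℝ f y v) (fderiv ℝ f y u) (W y) +
      christoffel G (f y) (fderiv ℝ f y u) (christoffel G (f y) (fderiv ℝ f y v) (W y)) -
      christoffel G (f y) (fderiv ℝ f y v) (christoffel G (f y) (fderiv ℝ f y u) (W y)) := by
  -- Second derivatives are symmetric and the mixed terms Γ(df v, DW u) occur once in each order, so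
  -- the commutator keeps only the terms of zeroth order in `W`.
  have e1 : fderiv ℝ (fderiv ℝ f) y u v = fderiv ℝ (fderiv ℝ f) y v u :=
    hf.isSymmSndFDerivAt (by simp) u v
  have e2 : fderiv ℝ (fderiv ℝ W) y u v = fderiv ℝ (fderiv ℝ W) y v u :=
    hW.isSymmSndFDerivAt (by simp) u v
  have hcov : ∀ (a : E) (X : E → F), covDerivAlong G f a X y =
    fderiv ℝ X y a + christoffel G (f y) (fderiv ℝ f y a) (X y) := fun _ _ => rfl
  rw [hcov u (covDerivAlong G f v W), hcov v (covDerivAlong G f u W),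
    (fderiv_covDerivAlong hΓ hf hW v).2, (fderiv_covDerivAlong hΓ hf hW u).2]
  simp only [hcov, map_add, e1, e2]
  abel

theorem riemannCoord_eq {x : F} (hΓ : DifferentiableAt ℝ (christoffel G) x) (u v w : F) :
    riemannCoord G x u v w = fderiv ℝ (christoffel G) x u v w - fderiv ℝ (christoffel G) x v u w +
      christoffel G x u (christoffel G x v w) - christoffel G x v (christoffel G x u w) := by
  have := covDerivAlong_comm (G := G) (f := id) (y := x) hΓ contDiffAt_id
    (contDiffAt_const (c := w)) u v
  simpa [riemannCoord] using this

theorem covDerivAlong_comm_eq_riemannCoord (hΓ : DifferentiableAt ℝ (christoffel G) (f y))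
    (hf : ContDiffAt ℝ 2 f y) {W : E → F} (hW : ContDiffAt ℝ 2 W y) (u v : E) :
    covDerivAlong G f u (covDerivAlong G f v W) y - covDerivAlong G f v (covDerivAlong G f u W) y =
      riemannCoord G (f y) (fderiv ℝ f y u) (fderiv ℝ f y v) (W y) := by
  rw [covDerivAlong_comm hΓ hf hW, riemannCoord_eq hΓ]

/-- Covariant differentiation along a map is compatible with the metric. -/
theorem IsMetricNear.fderiv_inner [FiniteDimensional ℝ F] (h : IsMetricNear G (f y))
    (hf : DifferentiableAt ℝ f y)
    {V W : E → F} (hV : DifferentiableAt ℝ V y) (hW : DifferentiableAt ℝ W y) (u : E) :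
    fderiv ℝ (fun z => G (f z) (V z) (W z)) y u =
      G (f y) (covDerivAlong G f u V y) (W y) + G (f y) (V y) (covDerivAlong G f u W y) := by
  have hc : HasFDerivAt (fun z => G (f z)) _ y :=
    h.differentiableAt.hasFDerivAt.comp y hf.hasFDerivAt
  rw [((hc.clm_apply hV.hasFDerivAt).clm_apply hW.hasFDerivAt).fderiv]
  simp [covDerivAlong, h.fderiv_eq]
  abel

end CovDeriv

section Curvature

variable [FiniteDimensional ℝ F] {G : F → F →L[ℝ] F →L[ℝ] ℝ} {y : F}

theorem IsMetricNear.differentiableAt_christoffel (h : IsMetricNear G y) :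
    DifferentiableAt ℝ (christoffel G) y :=
  h.contDiffAt_christoffel.differentiableAt (by simp)

theorem IsMetricNear.fderiv_christoffel_symm (h : IsMetricNear G y) (u v w : F) :
    fderiv ℝ (christoffel G) y u v w = fderiv ℝ (christoffel G) y u w v := by
  have h1 : ∀ v w : F, fderiv ℝ (fun z => christoffel G z v w) y u =
      fderiv ℝ (christoffel G) y u v w := by
    intro v w
    have := ((h.differentiableAt_christoffel.hasFDerivAt.clm_apply
      (hasFDerivAt_const v y)).clm_apply (hasFDerivAt_const w y)).fderiv
    rw [this]; simp
  rw [← h1, ← h1]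
  congr 1
  apply Filter.EventuallyEq.fderiv_eq
  filter_upwards [h.eventually] with z hz
  exact hz.christoffel_symm v w

/-- Torsion-freeness: `christoffel` and its derivative are symmetric in the lower slots, so the
cyclic sum cancels in pairs. -/
theorem IsMetricNear.bianchi (h : IsMetricNear G y) (u v w : F) :
    riemannCoord G y u v w + riemannCoord G y v w u + riemannCoord G y w u v = 0 := by
  have hΓ := h.differentiableAt_christoffel
  rw [riemannCoord_eq hΓ, riemannCoord_eq hΓ, riemannCoord_eq hΓ,
    h.fderiv_christoffel_symm u w v, h.fderiv_christoffel_symm v w u,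
    h.fderiv_christoffel_symm w v u, h.christoffel_symm w v, h.christoffel_symm w u,
    h.christoffel_symm v u]
  abel

/-- Differentiate G(w, w) twice using metric compatibility. The cross term G(∇_v w, ∇_u w) is
symmetric in u and v, so symmetry of the second derivative leaves only the curvature term. -/
theorem IsMetricNear.inner_riemannCoord_self (h : IsMetricNear G y) (u v w : F) :
    G y (riemannCoord G y u v w) w = 0 := by
  have hΓ := h.differentiableAt_christoffel
  have hw : ContDiffAt ℝ 2 (fun _ : F => w) y := contDiffAt_const
  have hD : ∀ v, DifferentiableAt ℝ (covDerivAlong G id v (fun _ => w)) y := fun v =>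
    (fderiv_covDerivAlong (f := id) hΓ contDiffAt_id hw v).1
  have first : ∀ v, ∀ᶠ z in 𝓝 y, fderiv ℝ (fun z => G z w w) z v =
      2 * G z (covDerivAlong G id v (fun _ => w) z) w := by
    intro v
    filter_upwards [h.eventually] with z hz
    have := hz.fderiv_inner (f := id) (y := z) differentiableAt_id
      (differentiableAt_const w) (differentiableAt_const w) v
    simp only [id] at this
    rw [this, hz.symm.self_of_nhds w]
    ring
  have second : ∀ u v, fderiv ℝ (fderiv ℝ (fun z => G z w w)) y u v =
      2 * (G y (covDerivAlong G id u (covDerivAlong G id v (fun _ => w)) y) w +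
        G y (covDerivAlong G id v (fun _ => w) y) (covDerivAlong G id u (fun _ => w) y)) := by
    intro u v
    have hC : ContDiffAt ℝ 2 (fun z => G z w w) y :=
      (h.contDiffAt.clm_apply contDiffAt_const).clm_apply contDiffAt_const
    have hC1 : DifferentiableAt ℝ (fderiv ℝ (fun z => G z w w)) y :=
      (hC.fderiv_right (m := 1) (by norm_num)).differentiableAt (by simp)
    have e1 : fderiv ℝ (fun z => fderiv ℝ (fun z => G z w w) z v) y u =
        fderiv ℝ (fderiv ℝ (fun z => G z w w)) y u v := by
      rw [(hC1.hasFDerivAt.clm_apply (hasFDerivAt_const v y)).fderiv]; simp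
    rw [← e1, Filter.EventuallyEq.fderiv_eq (first v)]
    have hd : DifferentiableAt ℝ
        (fun z => G z (covDerivAlong G id v (fun _ => w) z) w) y :=
      (h.differentiableAt.clm_apply (hD v)).clm_apply (differentiableAt_const w)
    have := h.fderiv_inner (f := id) (y := y) differentiableAt_id (hD v)
      (differentiableAt_const w) u
    simp only [id] at this
    rw [fderiv_const_mul hd, ← this]
    simp
  have hsymm : fderiv ℝ (fderiv ℝ (fun z => G z w w)) y u v =
      fderiv ℝ (fderiv ℝ (fun z => G z w w)) y v u :=
    ContDiffAt.isSymmSndFDerivAt (n := 2)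
      ((h.contDiffAt.clm_apply contDiffAt_const).clm_apply contDiffAt_const) (by simp) u v
  rw [second, second, h.symm.self_of_nhds (covDerivAlong G id v (fun _ => w) y)] at hsymm
  simp only [riemannCoord, map_sub, sub_apply]
  linarith

end Curvature

end Coordinates

/-! ### Sectional curvature determines the curvature tensor. -/

section CurvatureLike

variable {V : Type*} [AddCommGroup V]

/-- A curvature-like quadrilinear form whose sectional part vanishes is zero. -/
theorem eq_zero_of_curvatureLike (T : V → V → V → V → ℝ)
    (add₁ : ∀ u u' v w z, T (u + u') v w z = T u v w z + T u' v w z)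
    (add₃ : ∀ u v w w' z, T u v (w + w') z = T u v w z + T u v w' z)
    (anti₁₂ : ∀ u v w z, T u v w z = -T v u w z)
    (anti₃₄ : ∀ u v w z, T u v w z = -T u v z w)
    (bianchi : ∀ u v w z, T u v w z + T v w u z + T w u v z = 0)
    (sec : ∀ u v, T u v v u = 0) (u v w z : V) : T u v w z = 0 := by
  -- Pair symmetry is the usual combination of the four Bianchi identities on u, v, w, z.
  have pair : ∀ u v w z, T u v w z = T w z u v := by
    intro u v w z
    linarith [bianchi u v w z, bianchi v w z u, bianchi w z u v, bianchi z u v w,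
      anti₁₂ u v w z, anti₁₂ v w u z, anti₁₂ w u v z, anti₁₂ v w z u, anti₁₂ w z v u,
      anti₁₂ z v w u, anti₁₂ w z u v, anti₁₂ z u w v, anti₁₂ u w z v, anti₁₂ z u v w,
      anti₁₂ u v z w, anti₁₂ v z u w, anti₃₄ u v w z, anti₃₄ v w u z, anti₃₄ w u v z,
      anti₃₄ w z v u, anti₃₄ z v w u, anti₃₄ u z v w, anti₃₄ z u w v, anti₃₄ v z u w,
      anti₃₄ u w z v, anti₃₄ z u v w]
  have add₂ : ∀ u v v' w z, T u (v + v') w z = T u v w z + T u v' w z := by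
    intro u v v' w z
    linarith [anti₁₂ u (v + v') w z, anti₁₂ u v w z, anti₁₂ u v' w z, add₁ v v' u w z]
  have add₄ : ∀ u v w z z', T u v w (z + z') = T u v w z + T u v w z' := by
    intro u v w z z'
    linarith [anti₃₄ u v w (z + z'), anti₃₄ u v w z, anti₃₄ u v w z', add₃ u v z z' w]
  -- Polarize `sec` in the middle slots; pair symmetry identifies the two mixed terms.
  have h1 : ∀ u v w, T u v w u = 0 := by
    intro u v w
    have := sec u (v + w)
    rw [add₂, add₃, add₃, sec, sec] at this
    linarith [pair u w v u, anti₁₂ v u u w, anti₃₄ u v u w]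
  have h2 : ∀ u v w z, T u v w z = -T z v w u := by
    intro u v w z
    have := h1 (u + z) v w
    rw [add₁, add₄, add₄, h1, h1] at this
    linarith
  -- Skew in slots 1-2, 3-4 and now 1-4, `T` is totally alternating, so its three cyclic terms agree
  -- and Bianchi reads 3T = 0.
  linarith [bianchi u v w z, h2 v w u z, anti₁₂ z w u v, h2 w z u v, anti₁₂ v z u w, h2 z v u w,
    anti₁₂ w v u z, h2 v w u z, anti₃₄ v w u z, h2 v w z u, anti₁₂ u w z v, h2 w u z v,
    anti₁₂ v u z w, anti₃₄ u v z w, anti₁₂ w u v z, h2 u w v z, anti₁₂ z w v u, h2 w z v u,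
    anti₁₂ u z v w, anti₃₄ u v w z, anti₃₄ u w v z, anti₃₄ w u v z, h2 w u v z, h2 u w z v]

end CurvatureLike

/-! ### Constant curvature, immersions, and the Gauss and Ricci equations. -/

section Coordinates

variable {E F : Type*} [NormedAddCommGroup E] [NormedSpace ℝ E]
  [NormedAddCommGroup F] [NormedSpace ℝ F]

/-- Schur-type normal form of the curvature tensor at a point of constant sectional curvature. -/
theorem IsMetricNear.inner_riemannCoord_of_sectional_eq [FiniteDimensional ℝ F]
    {G : F → F →L[ℝ] F →L[ℝ] ℝ} {y : F} (h : IsMetricNear G y) {c : ℝ}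
    (hc : ∀ u v : F, LinearIndependent ℝ ![u, v] →
      G y (riemannCoord G y u v v) u / (G y u u * G y v v - G y u v ^ 2) = c) (u v w z : F) :
    G y (riemannCoord G y u v w) z = c * (G y v w * G y u z - G y u w * G y v z) := by
  have hΓ := h.differentiableAt_christoffel
  have hsymm := h.symm.self_of_nhds
  have hpos := h.pos.self_of_nhds
  have add₁ : ∀ u u' v w, riemannCoord G y (u + u') v w =
      riemannCoord G y u v w + riemannCoord G y u' v w := by
    intro u u' v w
    simp only [riemannCoord_eq hΓ, map_add, add_apply]
    abel
  have add₃ : ∀ u v w w', riemannCoord G y u v (w + w') =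
      riemannCoord G y u v w + riemannCoord G y u v w' := by
    intro u v w w'
    simp only [riemannCoord_eq hΓ, map_add]
    abel
  have smul₁ : ∀ (a : ℝ) (u v w : F), riemannCoord G y (a • u) v w =
      a • riemannCoord G y u v w := by
    intro a u v w
    simp only [riemannCoord_eq hΓ, map_smul, smul_apply, smul_sub, smul_add]
  have smul₂ : ∀ (a : ℝ) (u v w : F), riemannCoord G y u (a • v) w =
      a • riemannCoord G y u v w := by
    intro a u v w
    rw [riemannCoord_antisymm, smul₁, riemannCoord_antisymm G y v u, smul_neg, neg_neg]
  have self : ∀ u w, riemannCoord G y u u w = 0 := fun u w => by simp [riemannCoord]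
  -- The hypothesis only covers planes, whereas polarization needs all pairs; on dependent pairs
  -- both sides vanish.
  have sec : ∀ u v, G y (riemannCoord G y u v v) u = c * (G y u u * G y v v - G y u v ^ 2) := by
    intro u v
    by_cases hli : LinearIndependent ℝ ![u, v]
    · rw [← hc u v hli, div_mul_cancel₀]
      have hu : u ≠ 0 := by simpa using hli.ne_zero 0
      have hu' := hpos u hu
      -- Strict Cauchy-Schwarz: |u|² times the squared length of this Gram-Schmidt vector is the
      -- Gram determinant, the denominator to be cleared.
      have hne : v - (G y u v / G y u u) • u ≠ 0 := by
        intro h0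
        have := (LinearIndependent.pair_iff.1 hli) (-(G y u v / G y u u)) 1 (by
          rw [← h0]; module)
        exact one_ne_zero this.2
      have := hpos _ hne
      simp only [map_sub, map_smul, sub_apply, smul_apply, smul_eq_mul,
        hsymm v u] at this
      have h3 : 0 < G y u u * (G y v v - G y u v / G y u u * G y u v -
          G y u v / G y u u * (G y u v - G y u v / G y u u * G y u u)) := mul_pos hu' (by linarith)
      have h4 : G y u u * (G y v v - G y u v / G y u u * G y u v -
          G y u v / G y u u * (G y u v - G y u v / G y u u * G y u u)) =
          G y u u * G y v v - G y u v ^ 2 := by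
        field_simp; ring
      rw [h4] at h3
      exact h3.ne'
    · rw [LinearIndependent.pair_iff] at hli
      push Not at hli
      obtain ⟨s, t, hst, hne⟩ := hli
      by_cases hs : s = 0
      · have ht := hne hs
        have hv : v = 0 := by simpa [hs, ht] using hst
        have : riemannCoord G y u v v = 0 := by
          have := smul₂ 0 u v v
          simpa [hv] using this
        rw [this, hv]; simp
      · have hu : u = (-(t / s)) • v := by
          have h5 : s • u = s • ((-(t / s)) • v) := by
            rw [smul_smul, mul_neg, mul_div_cancel₀ _ hs, neg_smul]
            exact eq_neg_of_add_eq_zero_left hst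
          exact smul_right_injective F hs h5
        rw [hu, smul₁, self]
        simp
        ring_nf
        simp
  -- Subtracting the constant-curvature tensor leaves a curvature-like form without sectional part.
  have key := eq_zero_of_curvatureLike
    (fun u v w z => G y (riemannCoord G y u v w) z -
      c * (G y v w * G y u z - G y u w * G y v z))
    (fun u u' v w z => by simp only [add₁, map_add, add_apply]; ring)
    (fun u v w w' z => by simp only [add₃, map_add, add_apply]; ring)
    (fun u v w z => by
      rw [riemannCoord_antisymm G y u v w]; simp only [map_neg, neg_apply]; ring)
    (fun u v w z => by
      have := h.inner_riemannCoord_self u v (w + z)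
      simp only [add₃, map_add, add_apply, h.inner_riemannCoord_self] at this
      linarith)
    (fun u v w z => by
      have := congrArg (fun a => G y a z) (h.bianchi u v w)
      simp only [map_add, add_apply, map_zero, zero_apply] at this
      rw [hsymm w u, hsymm w v, hsymm v u]
      linarith)
    (fun u v => by
      rw [sec, hsymm v u]; ring)
    u v w z
  simpa [sub_eq_zero] using key

/-- `f` is a `C³` immersion near `y` into a space with metric `G`. -/
structure IsImmersionNear (G : F → F →L[ℝ] F →L[ℝ] ℝ) (f : E → F) (y : E) : Prop where
  metric : IsMetricNear G (f y)
  contDiffAt : ContDiffAt ℝ 3 f y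
  pos : ∀ᶠ z in 𝓝 y, ∀ u, u ≠ 0 → 0 < inducedMetric G f z u u

variable {G : F → F →L[ℝ] F →L[ℝ] ℝ} {f : E → F} {y : E}

@[simp] theorem inducedMetric_apply (u v : E) :
    inducedMetric G f y u v = G (f y) (fderiv ℝ f y u) (fderiv ℝ f y v) := rfl

theorem IsImmersionNear.eventually (h : IsImmersionNear G f y) :
    ∀ᶠ z in 𝓝 y, IsImmersionNear G f z := by
  filter_upwards [h.contDiffAt.continuousAt.eventually h.metric.eventually,
    h.contDiffAt.eventually (by simp), h.pos.eventually_nhds] with z h1 h2 h3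
  exact ⟨h1, h2, h3⟩

theorem IsImmersionNear.contDiffAt_fderiv (h : IsImmersionNear G f y) :
    ContDiffAt ℝ 2 (fderiv ℝ f) y := h.contDiffAt.fderiv_right (by norm_num)

theorem IsImmersionNear.differentiableAt (h : IsImmersionNear G f y) :
    DifferentiableAt ℝ f y := h.contDiffAt.differentiableAt (by simp)

theorem IsImmersionNear.contDiffAt_fderiv_apply (h : IsImmersionNear G f y) (w : E) :
    ContDiffAt ℝ 2 (fun z => fderiv ℝ f z w) y :=
  h.contDiffAt_fderiv.clm_apply contDiffAt_const

theorem IsImmersionNear.inducedMetric (h : IsImmersionNear G f y) :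
    IsMetricNear (inducedMetric G f) y where
  contDiffAt := by
    have h1 : ContDiffAt ℝ 2 (fun z => G (f z)) y :=
      h.metric.contDiffAt.comp y (h.contDiffAt.of_le (by norm_num))
    -- The pullback is precomposition with df in one slot, a flip, precomposition again, and a flip
    -- back; each operation preserves C².
    have h2 : ContDiffAt ℝ 2 (fun z => (G (f z) ∘L fderiv ℝ f z).flip) y :=
      (ContinuousLinearMap.flipₗᵢ ℝ E F ℝ).contDiff.contDiffAt.comp y
        (h1.clm_comp h.contDiffAt_fderiv)
    exact (ContinuousLinearMap.flipₗᵢ ℝ E E ℝ).contDiff.contDiffAt.comp y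
        (h2.clm_comp h.contDiffAt_fderiv)
  symm := by
    filter_upwards [h.contDiffAt.continuousAt.eventually h.metric.symm] with z hz u v
    exact hz _ _
  pos := h.pos

theorem normalPart_apply (w : F) :
    normalPart G f y w = w - fderiv ℝ f y (tangentialPart G f y w) := rfl

theorem secondFundCoord_apply (u v : E) :
    secondFundCoord G f y u v = normalPart G f y (fderiv ℝ (fderiv ℝ f) y u v +
      christoffel G (f y) (fderiv ℝ f y u) (fderiv ℝ f y v)) := rfl

theorem IsImmersionNear.covDerivAlong_fderiv (h : IsImmersionNear G f y) (u v : E) :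
    covDerivAlong G f u (fun z => fderiv ℝ f z v) y = fderiv ℝ (fderiv ℝ f) y u v +
      christoffel G (f y) (fderiv ℝ f y u) (fderiv ℝ f y v) := by
  have := ((h.contDiffAt_fderiv.differentiableAt (by simp)).hasFDerivAt.clm_apply
    (hasFDerivAt_const v y)).fderiv
  simp [covDerivAlong, this]

theorem IsImmersionNear.normalPart_covDerivAlong_fderiv (h : IsImmersionNear G f y) (u v : E) :
    normalPart G f y (covDerivAlong G f u (fun z => fderiv ℝ f z v) y) =
      secondFundCoord G f y u v := by
  rw [h.covDerivAlong_fderiv]; rfl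

theorem IsImmersionNear.covDerivAlong_fderiv_symm [FiniteDimensional ℝ F] (h : IsImmersionNear G f y)
    (u v : E) :
    covDerivAlong G f u (fun z => fderiv ℝ f z v) y =
      covDerivAlong G f v (fun z => fderiv ℝ f z u) y := by
  have e1 : fderiv ℝ (fderiv ℝ f) y u v = fderiv ℝ (fderiv ℝ f) y v u :=
    (h.contDiffAt.of_le (m := 2) (by norm_num)).isSymmSndFDerivAt (by simp) u v
  rw [h.covDerivAlong_fderiv, h.covDerivAlong_fderiv, e1, h.metric.christoffel_symm]

theorem IsImmersionNear.secondFundCoord_symm [FiniteDimensional ℝ F] (h : IsImmersionNear G f y) (u v : E) :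
    secondFundCoord G f y u v = secondFundCoord G f y v u := by
  rw [← h.normalPart_covDerivAlong_fderiv, h.covDerivAlong_fderiv_symm,
    h.normalPart_covDerivAlong_fderiv]

section TangentialNormal

variable [FiniteDimensional ℝ E]

theorem IsImmersionNear.inducedMetric_tangentialPart (h : IsImmersionNear G f y) (w : F) (v : E) :
    Casorati.inducedMetric G f y (tangentialPart G f y w) v = G (f y) w (fderiv ℝ f y v) := by
  have := h.inducedMetric.isInvertible.self_apply_inverse (G (f y) w ∘L fderiv ℝ f y)
  exact congrArg (fun α : E →L[ℝ] ℝ => α v) this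

theorem IsImmersionNear.tangentialPart_fderiv (h : IsImmersionNear G f y) (u : E) :
    tangentialPart G f y (fderiv ℝ f y u) = u :=
  h.inducedMetric.eq_of_forall fun v => by rw [h.inducedMetric_tangentialPart]; rfl

theorem IsImmersionNear.normalPart_fderiv (h : IsImmersionNear G f y) (u : E) :
    normalPart G f y (fderiv ℝ f y u) = 0 := by
  rw [normalPart_apply, h.tangentialPart_fderiv, sub_self]

theorem IsImmersionNear.inner_normalPart_fderiv (h : IsImmersionNear G f y) (w : F) (v : E) :
    G (f y) (normalPart G f y w) (fderiv ℝ f y v) = 0 := by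
  rw [normalPart_apply, map_sub, sub_apply, ← inducedMetric_apply,
    h.inducedMetric_tangentialPart, sub_self]

theorem IsImmersionNear.inner_secondFundCoord_fderiv (h : IsImmersionNear G f y) (u v w : E) :
    G (f y) (secondFundCoord G f y u v) (fderiv ℝ f y w) = 0 :=
  h.inner_normalPart_fderiv _ _

theorem IsImmersionNear.inducedMetric_shapeCoord (h : IsImmersionNear G f y) (ξ : F) (u v : E) :
    Casorati.inducedMetric G f y (shapeCoord G f y ξ u) v =
      G (f y) (secondFundCoord G f y u v) ξ := by
  have := h.inducedMetric.isInvertible.self_apply_inverse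
    ((G (f y)).flip ξ ∘L secondFundCoord G f y u)
  exact congrArg (fun α : E →L[ℝ] ℝ => α v) this

theorem IsImmersionNear.contDiffAt_tangentialPart (h : IsImmersionNear G f y) :
    ContDiffAt ℝ 2 (tangentialPart G f) y := by
  have h2 : ContDiffAt ℝ 2 (fun z => (Casorati.inducedMetric G f z).inverse) y :=
    h.inducedMetric.isInvertible.contDiffAt_map_inverse.comp y h.inducedMetric.contDiffAt
  have h1 : ContDiffAt ℝ 2 (fun z => G (f z)) y :=
    h.metric.contDiffAt.comp y (h.contDiffAt.of_le (by norm_num))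
  exact h2.clm_comp
    (((ContinuousLinearMap.compL ℝ E F ℝ).flip.contDiff.contDiffAt.comp y
      h.contDiffAt_fderiv).clm_comp h1)

variable [FiniteDimensional ℝ F]

/-- The tangential part of the ambient connection is the connection of the induced metric. -/
theorem IsImmersionNear.inner_covDerivAlong_fderiv (h : IsImmersionNear G f y) (u v w : E) :
    G (f y) (covDerivAlong G f u (fun z => fderiv ℝ f z v) y) (fderiv ℝ f y w) =
      Casorati.inducedMetric G f y (christoffel (Casorati.inducedMetric G f) y u v) w := by
  have hD : ∀ a b k, fderiv ℝ (Casorati.inducedMetric G f) y a b k =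
      G (f y) (covDerivAlong G f a (fun z => fderiv ℝ f z b) y) (fderiv ℝ f y k) +
      G (f y) (covDerivAlong G f a (fun z => fderiv ℝ f z k) y) (fderiv ℝ f y b) := by
    intro a b k
    have h1 := ((h.inducedMetric.differentiableAt.hasFDerivAt.clm_apply
      (hasFDerivAt_const b y)).clm_apply (hasFDerivAt_const k y)).fderiv
    have h2 := h.metric.fderiv_inner h.differentiableAt
      ((h.contDiffAt_fderiv_apply b).differentiableAt (by simp))
      ((h.contDiffAt_fderiv_apply k).differentiableAt (by simp)) a
    rw [h.metric.symm.self_of_nhds (fderiv ℝ f y b)] at h2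
    rw [← h2]
    have h3 := congrArg (fun α : E →L[ℝ] ℝ => α a) h1
    simpa using h3.symm
  -- In the Koszul formula for the induced metric, six ambient terms appear; the symmetry of D_u(df
  -- v) in u and v cancels four and doubles the wanted one.
  rw [h.inducedMetric.inner_christoffel, christoffelFirst_apply, hD, hD, hD,
    h.covDerivAlong_fderiv_symm w u, h.covDerivAlong_fderiv_symm v u,
    h.covDerivAlong_fderiv_symm w v]
  ring

theorem IsImmersionNear.covDerivAlong_fderiv_eq (h : IsImmersionNear G f y) (u v : E) :
    covDerivAlong G f u (fun z => fderiv ℝ f z v) y =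
      fderiv ℝ f y (christoffel (Casorati.inducedMetric G f) y u v) +
        secondFundCoord G f y u v := by
  have h1 : tangentialPart G f y (covDerivAlong G f u (fun z => fderiv ℝ f z v) y) =
      christoffel (Casorati.inducedMetric G f) y u v :=
    h.inducedMetric.eq_of_forall fun w => by
      rw [h.inducedMetric_tangentialPart, h.inner_covDerivAlong_fderiv]
  rw [← h.normalPart_covDerivAlong_fderiv, normalPart_apply, h1]
  abel

/-- **Gauss equation**. -/
theorem IsImmersionNear.gauss (h : IsImmersionNear G f y) (u v w k : E) :
    Casorati.inducedMetric G f y (riemannCoord (Casorati.inducedMetric G f) y u v w) k =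
      G (f y) (riemannCoord G (f y) (fderiv ℝ f y u) (fderiv ℝ f y v) (fderiv ℝ f y w))
        (fderiv ℝ f y k) +
      G (f y) (secondFundCoord G f y v w) (secondFundCoord G f y u k) -
      G (f y) (secondFundCoord G f y u w) (secondFundCoord G f y v k) := by
  set g := Casorati.inducedMetric G f with hg
  have hΓ := h.metric.differentiableAt_christoffel
  have hf2 : ContDiffAt ℝ 2 f y := h.contDiffAt.of_le (by norm_num)
  have hP : ∀ (v w z : E), covDerivAlong g id v (fun _ => w) z = christoffel g z v w := by
    intro v w z; simp [covDerivAlong]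
  have key : ∀ u v, g y (covDerivAlong g id u (covDerivAlong g id v (fun _ => w)) y) k =
      G (f y) (covDerivAlong G f u (covDerivAlong G f v (fun z => fderiv ℝ f z w)) y)
        (fderiv ℝ f y k) +
      G (f y) (secondFundCoord G f y v w) (secondFundCoord G f y u k) := by
    intro u v
    have hDv : DifferentiableAt ℝ (covDerivAlong g id v (fun _ => w)) y :=
      (fderiv_covDerivAlong (f := id) h.inducedMetric.differentiableAt_christoffel
        contDiffAt_id contDiffAt_const v).1
    have hDf : DifferentiableAt ℝ (covDerivAlong G f v (fun z => fderiv ℝ f z w)) y :=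
      (fderiv_covDerivAlong hΓ hf2 (h.contDiffAt_fderiv_apply w) v).1
    have e1 := h.inducedMetric.fderiv_inner (f := id) (y := y) differentiableAt_id hDv
      (differentiableAt_const k) u
    have e2 := h.metric.fderiv_inner h.differentiableAt hDf
      ((h.contDiffAt_fderiv_apply k).differentiableAt (by simp)) u
    have e3 : (fun z => g (id z) (covDerivAlong g id v (fun _ => w) z) k) =ᶠ[𝓝 y]
        fun z => G (f z) (covDerivAlong G f v (fun z => fderiv ℝ f z w) z) (fderiv ℝ f z k) := by
      filter_upwards [h.eventually] with z hz
      rw [hz.inner_covDerivAlong_fderiv, hP]; rfl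
    rw [e3.fderiv_eq, e2] at e1
    have e4 : G (f y) (covDerivAlong G f v (fun z => fderiv ℝ f z w) y)
        (covDerivAlong G f u (fun z => fderiv ℝ f z k) y) =
        g y (christoffel g y v w) (christoffel g y u k) +
        G (f y) (secondFundCoord G f y v w) (secondFundCoord G f y u k) := by
      rw [h.covDerivAlong_fderiv_eq, h.covDerivAlong_fderiv_eq]
      simp only [map_add, add_apply, h.inner_secondFundCoord_fderiv]
      rw [h.metric.symm.self_of_nhds (fderiv ℝ f y _) (secondFundCoord G f y u k),
        h.inner_secondFundCoord_fderiv]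
      simp [hg]
    rw [e4, hP, hP] at e1
    simp only [id] at e1
    change _ = g y _ _ + g y _ _ at e1
    linarith
  rw [← covDerivAlong_comm_eq_riemannCoord hΓ hf2 (h.contDiffAt_fderiv_apply w) u v]
  rw [riemannCoord]
  simp only [map_sub, sub_apply]
  rw [key, key]
  ring

/-- **Ricci equation**. -/
theorem IsImmersionNear.ricci (h : IsImmersionNear G f y) {ξ : E → F} (hξ : ContDiffAt ℝ 2 ξ y)
    (hn : ∀ᶠ z in 𝓝 y, ∀ u, G (f z) (fderiv ℝ f z u) (ξ z) = 0) (u v : E) :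
    normalCurvCoord G f u v ξ y =
      normalPart G f y (riemannCoord G (f y) (fderiv ℝ f y u) (fderiv ℝ f y v) (ξ y)) +
      secondFundCoord G f y u (shapeCoord G f y (ξ y) v) -
      secondFundCoord G f y v (shapeCoord G f y (ξ y) u) := by
  have hΓ := h.metric.differentiableAt_christoffel
  have hf2 : ContDiffAt ℝ 2 f y := h.contDiffAt.of_le (by norm_num)
  have hD : ∀ v, DifferentiableAt ℝ (covDerivAlong G f v ξ) y := fun v =>
    (fderiv_covDerivAlong hΓ hf2 hξ v).1
  -- Weingarten formula: differentiate G(df w, ξ) = 0, which holds on a whole neighbourhood.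
  have weingarten : ∀ v, tangentialPart G f y (covDerivAlong G f v ξ y) =
      - shapeCoord G f y (ξ y) v := by
    intro v
    refine h.inducedMetric.eq_of_forall fun w => ?_
    rw [h.inducedMetric_tangentialPart, map_neg, neg_apply, h.inducedMetric_shapeCoord]
    have e1 := h.metric.fderiv_inner h.differentiableAt
      ((h.contDiffAt_fderiv_apply w).differentiableAt (by simp))
      (hξ.differentiableAt (by simp)) v
    have e2 : (fun z => G (f z) (fderiv ℝ f z w) (ξ z)) =ᶠ[𝓝 y] fun _ => 0 := by
      filter_upwards [hn] with z hz using hz w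
    rw [e2.fderiv_eq, h.covDerivAlong_fderiv_eq, map_add, add_apply, hn.self_of_nhds,
      h.metric.symm.self_of_nhds (fderiv ℝ f y w)] at e1
    simp at e1
    linarith
  -- Removing the tangential part of D_v ξ adds df(A_ξ v) to it. The normal part of D_u of that
  -- field is h(u, A_ξ v), since the derivative of the tangent coefficient stays tangential.
  have key : ∀ u v, normalConnCoord G f u (normalConnCoord G f v ξ) y =
      normalPart G f y (covDerivAlong G f u (covDerivAlong G f v ξ) y) +
      secondFundCoord G f y u (shapeCoord G f y (ξ y) v) := by
    intro u v
    have ht : DifferentiableAt ℝ (fun z => tangentialPart G f z (covDerivAlong G f v ξ z)) y :=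
      (h.contDiffAt_tangentialPart.differentiableAt (by simp)).clm_apply (hD v)
    have hdt := (h.contDiffAt_fderiv.differentiableAt (by simp)).hasFDerivAt.clm_apply
      ht.hasFDerivAt
    have e1 : fderiv ℝ (normalConnCoord G f v ξ) y = _ :=
      ((hD v).hasFDerivAt.sub hdt).fderiv
    have e2 : normalConnCoord G f v ξ y = covDerivAlong G f v ξ y -
      fderiv ℝ f y (tangentialPart G f y (covDerivAlong G f v ξ y)) := rfl
    rw [normalConnCoord, covDerivAlong, e1, e2, weingarten]
    simp only [sub_apply, map_add, map_sub, map_neg, covDerivAlong, secondFundCoord_apply,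
      add_apply, neg_apply, ContinuousLinearMap.comp_apply, ContinuousLinearMap.flip_apply,
      h.normalPart_fderiv]
    abel
  rw [normalCurvCoord, key, key,
    ← covDerivAlong_comm_eq_riemannCoord hΓ hf2 hξ u v, map_sub]
  abel

end TangentialNormal

end Coordinates

/-! ### Passage from manifolds to charts. -/

section Charts

variable {m : ℕ} {M : Type*} [TopologicalSpace M] [ChartedSpace (EuclideanSpace ℝ (Fin m)) M]
  [IsManifold (𝓡 m) ∞ M]

theorem mdifferentiableAt_extChartAt_symm {x : M} {y : EuclideanSpace ℝ (Fin m)}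
    (hy : y ∈ (extChartAt (𝓡 m) x).target) :
    MDifferentiableAt (𝓡 m) (𝓡 m) (extChartAt (𝓡 m) x).symm y := by
  have : IsManifold (𝓡 m) 1 M := IsManifold.of_le (n := ∞) (by simp)
  have := mdifferentiableWithinAt_extChartAt_symm (I := 𝓡 m) hy
  rwa [ModelWithCorners.range_eq_univ, mdifferentiableWithinAt_univ] at this

theorem mfderiv_extChartAt_symm_self (x : M) :
    mfderiv (𝓡 m) (𝓡 m) (extChartAt (𝓡 m) x).symm (extChartAt (𝓡 m) x x) =
      ContinuousLinearMap.id ℝ (EuclideanSpace ℝ (Fin m)) := by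
  have : IsManifold (𝓡 m) 1 M := IsManifold.of_le (n := ∞) (by simp)
  have := mfderivWithin_range_extChartAt_symm (I := 𝓡 m) (x := x)
  rwa [ModelWithCorners.range_eq_univ, mfderivWithin_univ] at this

/-- Moves the base point along an equality while the vectors stay fixed in the common model space.
-/
theorem metric_inner_congr (g : Metric m M) {p q : M} (h : p = q)
    (a b : EuclideanSpace ℝ (Fin m)) :
    g.inner p (a : TangentSpace (𝓡 m) p) (b : TangentSpace (𝓡 m) p) =
      g.inner q (a : TangentSpace (𝓡 m) q) (b : TangentSpace (𝓡 m) q) := by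
  subst h; rfl

theorem chartMetric_self (g : Metric m M) (x : M) (u v : TangentSpace (𝓡 m) x) :
    chartMetric g x (extChartAt (𝓡 m) x x) u v = g.inner x u v := by
  have e : ∀ u : EuclideanSpace ℝ (Fin m), (mfderiv (𝓡 m) (𝓡 m) (extChartAt (𝓡 m) x).symm
      (extChartAt (𝓡 m) x x) u : EuclideanSpace ℝ (Fin m)) = u :=
    fun u => DFunLike.congr_fun (mfderiv_extChartAt_symm_self x) u
  exact (metric_inner_congr g (extChartAt_to_inv x) _ _).trans
    (congrArg₂ (fun a b : EuclideanSpace ℝ (Fin m) =>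
      g.inner x (a : TangentSpace (𝓡 m) x) (b : TangentSpace (𝓡 m) x)) (e u) (e v))

theorem contMDiffOn_mfderiv_extChartAt_symm (x : M) (u : EuclideanSpace ℝ (Fin m)) :
    ContMDiffOn (𝓡 m) ((𝓡 m).prod (𝓡 m)) ∞
      (fun y => (⟨(extChartAt (𝓡 m) x).symm y,
        mfderiv (𝓡 m) (𝓡 m) (extChartAt (𝓡 m) x).symm y u⟩ : TangentBundle (𝓡 m) M))
      (extChartAt (𝓡 m) x).target := by
  have hopen := isOpen_extChartAt_target (I := 𝓡 m) x
  have h1 : ContMDiffOn (𝓡 m) (𝓡 m) ∞ (extChartAt (𝓡 m) x).symm (extChartAt (𝓡 m) x).target :=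
    contMDiffOn_extChartAt_symm x
  have h2 := h1.contMDiffOn_tangentMapWithin (m := ∞) (by simp) hopen.uniqueMDiffOn
  have h3 : ContMDiff (𝓡 m) ((𝓡 m).prod (𝓡 m)) ∞ (fun y : EuclideanSpace ℝ (Fin m) =>
      (⟨y, u⟩ : TangentBundle (𝓡 m) (EuclideanSpace ℝ (Fin m)))) :=
    contMDiff_vectorSpace_iff_contDiff.2 contDiff_const
  refine (h2.comp h3.contMDiffOn (fun y hy => hy)).congr fun y hy => ?_
  simp only [Function.comp, tangentMapWithin]
  rw [mfderivWithin_of_isOpen hopen hy]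

/-- The derivative of the inverse chart on a constant vector is a smooth field along the inverse
chart, and the smooth metric pairs two such fields. -/
theorem contDiffOn_chartMetric (g : Metric m M) (x : M) :
    ContDiffOn ℝ ∞ (chartMetric g x) (extChartAt (𝓡 m) x).target := by
  rw [contDiffOn_clm_apply]
  intro u
  rw [contDiffOn_clm_apply]
  intro v
  rw [← contMDiffOn_iff_contDiffOn]
  intro y hy
  have h1 : ContMDiffWithinAt (𝓡 m) (𝓡 m) ∞ (extChartAt (𝓡 m) x).symm
    (extChartAt (𝓡 m) x).target y := contMDiffOn_extChartAt_symm x y hy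
  have h2 : ContMDiffWithinAt (𝓡 m) ((𝓡 m).prod 𝓘(ℝ, ℝ)) ∞
      (fun y => Bundle.TotalSpace.mk' ℝ (E := Bundle.Trivial M ℝ) ((extChartAt (𝓡 m) x).symm y)
        (g.inner ((extChartAt (𝓡 m) x).symm y)
          (mfderiv (𝓡 m) (𝓡 m) (extChartAt (𝓡 m) x).symm y u)
          (mfderiv (𝓡 m) (𝓡 m) (extChartAt (𝓡 m) x).symm y v)))
      (extChartAt (𝓡 m) x).target y := by
    apply ContMDiffWithinAt.clm_bundle_apply₂ (F₁ := EuclideanSpace ℝ (Fin m))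
      (F₂ := EuclideanSpace ℝ (Fin m))
    · exact ContMDiffAt.comp_contMDiffWithinAt y g.contMDiff.contMDiffAt h1
    · exact contMDiffOn_mfderiv_extChartAt_symm x u y hy
    · exact contMDiffOn_mfderiv_extChartAt_symm x v y hy
  simp only [Bundle.contMDiffWithinAt_totalSpace] at h2
  exact h2.2

theorem isMetricNear_chartMetric (g : Metric m M) (x : M) :
    IsMetricNear (chartMetric g x) (extChartAt (𝓡 m) x x) where
  contDiffAt := ((contDiffOn_chartMetric g x).contDiffAt (extChartAt_target_mem_nhds x)).of_le
    ENat.LEInfty.out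
  symm := Filter.Eventually.of_forall fun z u v => g.symm _ _ _
  pos := by
    filter_upwards [extChartAt_target_mem_nhds x] with z hz u hu
    have : IsManifold (𝓡 m) 1 M := IsManifold.of_le (n := ∞) (by simp)
    have hinv := isInvertible_mfderivWithin_extChartAt_symm (I := 𝓡 m) hz
    rw [ModelWithCorners.range_eq_univ, mfderivWithin_univ] at hinv
    rw [chartMetric_apply]
    exact g.pos _ _ fun h0 => hu (hinv.injective (h0.trans (map_zero _).symm))

end Charts

section Immersions

theorem writtenInExtChartAt_self {n d : ℕ}
    {M : Type*} [TopologicalSpace M] [ChartedSpace (EuclideanSpace ℝ (Fin n)) M]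
    {N : Type*} [TopologicalSpace N] [ChartedSpace (EuclideanSpace ℝ (Fin d)) N]
    (φ : M → N) (x : M) :
    writtenInExtChartAt (𝓡 n) (𝓡 d) x φ (extChartAt (𝓡 n) x x) =
      extChartAt (𝓡 d) (φ x) (φ x) := by
  simp [writtenInExtChartAt]

variable {n d : ℕ}
  {M : Type*} [TopologicalSpace M] [ChartedSpace (EuclideanSpace ℝ (Fin n)) M]
  [IsManifold (𝓡 n) ∞ M]
  {N : Type*} [TopologicalSpace N] [ChartedSpace (EuclideanSpace ℝ (Fin d)) N]
  [IsManifold (𝓡 d) ∞ N] {g : Metric n M} {gN : Metric d N} {φ : M → N}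

theorem IsIsometricImmersion.contDiffAt (h : IsIsometricImmersion g gN φ) (x : M) :
    ContDiffAt ℝ ∞ (writtenInExtChartAt (𝓡 n) (𝓡 d) x φ) (extChartAt (𝓡 n) x x) := by
  have := (contMDiffAt_iff.1 (h.contMDiff x)).2
  rwa [ModelWithCorners.range_eq_univ, contDiffWithinAt_univ] at this

theorem IsIsometricImmersion.mdifferentiableAt (h : IsIsometricImmersion g gN φ) (x : M) :
    MDifferentiableAt (𝓡 n) (𝓡 d) φ x :=
  (h.contMDiff x).mdifferentiableAt (by simp)

theorem IsIsometricImmersion.fderiv_eq (h : IsIsometricImmersion g gN φ) (x : M) :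
    fderiv ℝ (writtenInExtChartAt (𝓡 n) (𝓡 d) x φ) (extChartAt (𝓡 n) x x) =
      mfderiv (𝓡 n) (𝓡 d) φ x := by
  rw [(h.mdifferentiableAt x).mfderiv, ModelWithCorners.range_eq_univ, fderivWithin_univ]

/-- The chain rule on the two factorizations of φ ∘ chart⁻¹ turns the isometry of φ into an equality
of metrics. Equality near the point is needed because curvature differentiates the metric twice. -/
theorem IsIsometricImmersion.chartMetric_eventuallyEq (h : IsIsometricImmersion g gN φ) (x : M) :
    chartMetric g x =ᶠ[𝓝 (extChartAt (𝓡 n) x x)]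
      inducedMetric (chartMetric gN (φ x)) (writtenInExtChartAt (𝓡 n) (𝓡 d) x φ) := by
  set f := writtenInExtChartAt (𝓡 n) (𝓡 d) x φ with hf
  have hs : ∀ᶠ z in 𝓝 (extChartAt (𝓡 n) x x),
      φ ((extChartAt (𝓡 n) x).symm z) ∈ (extChartAt (𝓡 d) (φ x)).source := by
    have hc : ContinuousAt (fun z => φ ((extChartAt (𝓡 n) x).symm z)) (extChartAt (𝓡 n) x x) := by
      refine ContinuousAt.comp ?_ (continuousAt_extChartAt_symm x)
      rw [extChartAt_to_inv]
      exact h.contMDiff.continuous.continuousAt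
    refine hc.eventually_mem ((isOpen_extChartAt_source (φ x)).mem_nhds ?_)
    rw [extChartAt_to_inv]
    exact mem_extChartAt_source (φ x)
  filter_upwards [hs.eventually_nhds, extChartAt_target_mem_nhds x,
    ((h.contDiffAt x).of_le (m := 1) (by exact_mod_cast le_top)).eventually (by simp)]
    with z hz hzt hfz
  have hdz : MDifferentiableAt (𝓡 n) (𝓡 d) f z :=
    (hfz.differentiableAt (by simp)).mdifferentiableAt
  have hft : f z ∈ (extChartAt (𝓡 d) (φ x)).target :=
    (extChartAt (𝓡 d) (φ x)).map_source hz.self_of_nhds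
  have heq : (extChartAt (𝓡 d) (φ x)).symm ∘ f =ᶠ[𝓝 z] φ ∘ (extChartAt (𝓡 n) x).symm := by
    filter_upwards [hz] with z' hz'
    exact (extChartAt (𝓡 d) (φ x)).left_inv hz'
  have hD : ∀ u : EuclideanSpace ℝ (Fin n),
      (mfderiv (𝓡 d) (𝓡 d) (extChartAt (𝓡 d) (φ x)).symm (f z) (fderiv ℝ f z u) :
        EuclideanSpace ℝ (Fin d)) =
      mfderiv (𝓡 n) (𝓡 d) φ ((extChartAt (𝓡 n) x).symm z)
        (mfderiv (𝓡 n) (𝓡 n) (extChartAt (𝓡 n) x).symm z u) := by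
    intro u
    have e1 := mfderiv_comp z (mdifferentiableAt_extChartAt_symm hft) hdz
    have e2 := mfderiv_comp z (h.mdifferentiableAt _) (mdifferentiableAt_extChartAt_symm hzt)
    have e3 := heq.mfderiv_eq (I := 𝓡 n) (I' := 𝓡 d)
    rw [mfderiv_eq_fderiv] at e1
    have e4 : (mfderiv (𝓡 n) (𝓡 d) ((extChartAt (𝓡 d) (φ x)).symm ∘ f) z u :
        EuclideanSpace ℝ (Fin d)) =
        mfderiv (𝓡 n) (𝓡 d) (φ ∘ (extChartAt (𝓡 n) x).symm) z u :=
      DFunLike.congr_fun e3 u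
    exact (DFunLike.congr_fun e1 u).symm.trans (e4.trans (DFunLike.congr_fun e2 u))
  ext u v
  rw [inducedMetric_apply, chartMetric_apply, chartMetric_apply, ← h.isometric]
  refine (metric_inner_congr gN heq.self_of_nhds.symm _ _).trans ?_
  rw [← hD u, ← hD v]
  rfl

theorem IsIsometricImmersion.isImmersionNear (h : IsIsometricImmersion g gN φ) (x : M) :
    IsImmersionNear (chartMetric gN (φ x)) (writtenInExtChartAt (𝓡 n) (𝓡 d) x φ)
      (extChartAt (𝓡 n) x x) where
  metric := by
    rw [writtenInExtChartAt_self]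
    exact isMetricNear_chartMetric gN (φ x)
  contDiffAt := (h.contDiffAt x).of_le ENat.LEInfty.out
  pos := by
    filter_upwards [h.chartMetric_eventuallyEq x, (isMetricNear_chartMetric g x).pos] with z h1 h2
    rwa [← h1]

end Immersions

/-! ### Orthonormal bases for abstract inner products. -/

section InnerForms

/-- `B` is an inner product on the real vector space `V`. -/
structure IsInnerForm {V : Type*} [AddCommGroup V] [Module ℝ V] (B : V →ₗ[ℝ] V →ₗ[ℝ] ℝ) :
    Prop where
  symm : ∀ v w, B v w = B w v
  pos : ∀ v, v ≠ 0 → 0 < B v v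

variable {V : Type*} [AddCommGroup V] [Module ℝ V] {B : V →ₗ[ℝ] V →ₗ[ℝ] ℝ}
  {ι κ : Type*} [Fintype ι] [DecidableEq ι] [Fintype κ] [DecidableEq κ]

theorem IsInnerForm.nonneg (hB : IsInnerForm B) (v : V) : 0 ≤ B v v := by
  by_cases h : v = 0
  · simp [h]
  · exact (hB.pos v h).le

theorem IsInnerForm.eq_zero (hB : IsInnerForm B) {v : V} (h : B v v = 0) : v = 0 := by
  by_contra hv
  exact (hB.pos v hv).ne' h

/-- The inner product space core of an inner product. -/
abbrev IsInnerForm.core (hB : IsInnerForm B) : InnerProductSpace.Core ℝ V where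
  inner v w := B v w
  conj_inner_symm v w := by simp [hB.symm w v]
  re_inner_nonneg v := by simpa using hB.nonneg v
  add_left u v w := by simp
  smul_left u v r := by simp
  definite v h := hB.eq_zero h

/-- A partially prescribed orthonormal family can be completed to an orthonormal basis. -/
theorem IsInnerForm.exists_isOrthonormal_extension [FiniteDimensional ℝ V] (hB : IsInnerForm B)
    (hcard : Module.finrank ℝ V = Fintype.card ι) (v : ι → V) (s : Set ι)
    (hv : ∀ i ∈ s, ∀ j ∈ s, B (v i) (v j) = if i = j then 1 else 0) :
    ∃ b : ι → V, IsOrthonormal (fun v w => B v w) b ∧ ∀ i ∈ s, b i = v i := by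
  let _ : NormedAddCommGroup V := hB.core.toNormedAddCommGroup
  let _ : InnerProductSpace ℝ V := InnerProductSpace.ofCore hB.core.toCore
  have ho : Orthonormal ℝ (s.domRestrict v) := by
    classical
    rw [orthonormal_iff_ite]
    intro i j
    refine (hv i i.2 j j.2).trans ?_
    simp [Subtype.ext_iff]
  obtain ⟨b, hb⟩ := ho.exists_orthonormalBasis_extension_of_card_eq hcard
  exact ⟨b, fun i j => orthonormal_iff_ite.1 b.orthonormal i j, hb⟩

theorem IsInnerForm.linearIndependent {ι : Type*} [DecidableEq ι] (hB : IsInnerForm B) {e : ι → V}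
    (he : IsOrthonormal (fun v w => B v w) e) : LinearIndependent ℝ e := by
  let _ : NormedAddCommGroup V := hB.core.toNormedAddCommGroup
  let _ : InnerProductSpace ℝ V := InnerProductSpace.ofCore hB.core.toCore
  have ho : Orthonormal ℝ e := orthonormal_iff_ite.2 fun i j => he i j
  exact ho.linearIndependent

theorem IsInnerForm.sum_smul [FiniteDimensional ℝ V] (hB : IsInnerForm B) {e : ι → V}
    (he : IsOrthonormal (fun v w => B v w) e) (hcard : Module.finrank ℝ V = Fintype.card ι)
    (v : V) : ∑ i, B v (e i) • e i = v := by
  have hspan := (hB.linearIndependent he).span_eq_top_of_card_eq_finrank' hcard.symm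
  have hmem : v ∈ Submodule.span ℝ (Set.range e) := hspan ▸ Submodule.mem_top
  obtain ⟨c, rfl⟩ := (Submodule.mem_span_range_iff_exists_fun ℝ).1 hmem
  refine Finset.sum_congr rfl fun i _ => ?_
  have : ∀ j, B (e j) (e i) = if j = i then 1 else 0 := fun j => he j i
  simp [this]

theorem IsInnerForm.sum_mul [FiniteDimensional ℝ V] (hB : IsInnerForm B) {e : ι → V}
    (he : IsOrthonormal (fun v w => B v w) e) (hcard : Module.finrank ℝ V = Fintype.card ι)
    (u v : V) : ∑ i, B (e i) u * B (e i) v = B u v := by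
  conv_rhs => rw [← hB.sum_smul he hcard u]
  simp [hB.symm u]

/-- The trace of a bilinear map does not depend on the orthonormal basis. -/
theorem IsInnerForm.sum_bilin_eq [FiniteDimensional ℝ V] (hB : IsInnerForm B)
    {e : ι → V} (he : IsOrthonormal (fun v w => B v w) e)
    (hcard : Module.finrank ℝ V = Fintype.card ι)
    {e' : κ → V} (he' : IsOrthonormal (fun v w => B v w) e')
    (hcard' : Module.finrank ℝ V = Fintype.card κ)
    {X : Type*} [AddCommGroup X] [Module ℝ X] (β : V →ₗ[ℝ] V →ₗ[ℝ] X) :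
    ∑ i, β (e i) (e i) = ∑ j, β (e' j) (e' j) := by
  have h1 : ∀ i, β (e i) (e i) = ∑ j, β (B (e' j) (e i) • e i) (e' j) := by
    intro i
    have : β (e i) (e i) = β (e i) (∑ j, B (e i) (e' j) • e' j) := by
      rw [hB.sum_smul he' hcard' (e i)]
    rw [this]
    simp [hB.symm (e i)]
  simp only [h1]
  rw [Finset.sum_comm]
  refine Finset.sum_congr rfl fun j _ => ?_
  conv_rhs => enter [1]; rw [← hB.sum_smul he hcard (e' j)]
  simp

end InnerForms

/-! ### The algebraic inequality for vector-valued symmetric forms. -/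

section SecondFundamentalForms

variable {V W : Type*} [AddCommGroup V] [Module ℝ V] [AddCommGroup W] [Module ℝ W]
  {B : V →ₗ[ℝ] V →ₗ[ℝ] ℝ} {H : W →ₗ[ℝ] W →ₗ[ℝ] ℝ} {h : V →ₗ[ℝ] V →ₗ[ℝ] W}
  {ι κ : Type*} [Fintype ι] [DecidableEq ι] [Fintype κ] [DecidableEq κ]

/-- `∑_{i, j} |h(e_i, e_j)|²`. -/
def sumSq (H : W →ₗ[ℝ] W →ₗ[ℝ] ℝ) (h : V →ₗ[ℝ] V →ₗ[ℝ] W) (e : ι → V) : ℝ :=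
  ∑ i, ∑ j, H (h (e i) (e j)) (h (e i) (e j))

/-- `|h|² - 2 ∑_i |h(e_i, ν)|² + |h(ν, ν)|²`: for an orthonormal basis `e` and a unit vector `ν`
this is the squared norm of the restriction of `h` to the hyperplane orthogonal to `ν`. -/
def hyperplaneSq (H : W →ₗ[ℝ] W →ₗ[ℝ] ℝ) (h : V →ₗ[ℝ] V →ₗ[ℝ] W) (e : ι → V) (ν : V) : ℝ :=
  sumSq H h e - 2 * ∑ i, H (h (e i) ν) (h (e i) ν) + H (h ν ν) (h ν ν)

/-- Bases are indexed by `Option κ`: `none` carries the normal of the hyperplane, `some` a basis of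
the hyperplane. -/
theorem sumSq_option {κ : Type*} [Fintype κ] (hsymm : ∀ u v, h u v = h v u) (b : Option κ → V) :
    sumSq H h b = sumSq H h (fun i => b (some i)) +
      2 * ∑ i, H (h (b (some i)) (b none)) (h (b (some i)) (b none)) +
      H (h (b none) (b none)) (h (b none) (b none)) := by
  simp only [sumSq, Fintype.sum_option, Finset.sum_add_distrib,
    hsymm (b none) (b (some _))]
  ring

/-- Completes the square around the minimizer of the left-hand sum for a fixed trace: weight ½ on
the κ diagonal entries and weight 1 on the last one put it at 2t, …, 2t, t. The inverse weights add
up to 2|κ| + 1, which is 2n - 1 in dimension n = |κ| + 1. -/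
theorem sumSq_sub_eq_sum_sq (hH : IsInnerForm H) (hsymm : ∀ u v, h u v = h v u)
    (b : Option κ → V) (t : W)
    (ht : ∑ i, h (b i) (b i) = (2 * (Fintype.card κ : ℝ) + 1) • t) :
    sumSq H h b - sumSq H h (fun i => b (some i)) / 2 - (2 * (Fintype.card κ : ℝ) + 1) * H t t =
      (∑ i, ∑ j, H (h (b (some i)) (b (some j)) - (if i = j then (2 : ℝ) else 0) • t)
        (h (b (some i)) (b (some j)) - (if i = j then (2 : ℝ) else 0) • t)) / 2 +
      2 * ∑ i, H (h (b (some i)) (b none)) (h (b (some i)) (b none)) +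
      H (h (b none) (b none) - t) (h (b none) (b none) - t) := by
  have e1 : ∑ i, ∑ j, H (h (b (some i)) (b (some j)) - (if i = j then (2 : ℝ) else 0) • t)
        (h (b (some i)) (b (some j)) - (if i = j then (2 : ℝ) else 0) • t) =
      sumSq H h (fun i => b (some i)) -
        4 * H (∑ i, h (b (some i)) (b (some i))) t + 4 * Fintype.card κ * H t t := by
    have : ∀ i j, H (h (b (some i)) (b (some j)) - (if i = j then (2 : ℝ) else 0) • t)
        (h (b (some i)) (b (some j)) - (if i = j then (2 : ℝ) else 0) • t) =
        H (h (b (some i)) (b (some j))) (h (b (some i)) (b (some j))) +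
        if i = j then (4 * H t t - 4 * H (h (b (some i)) (b (some i))) t) else 0 := by
      intro i j
      split_ifs with hij
      · subst hij
        simp [hH.symm t]
        ring
      · simp
    simp only [this, Finset.sum_add_distrib, Finset.sum_ite_eq, Finset.mem_univ, if_true,
      Finset.sum_sub_distrib, sumSq, Finset.sum_const, Finset.card_univ, nsmul_eq_mul, map_sum,
      LinearMap.sum_apply, ← Finset.mul_sum]
    ring
  rw [Fintype.sum_option] at ht
  have e2 : H (∑ i, h (b (some i)) (b (some i))) t =
      (2 * (Fintype.card κ : ℝ) + 1) * H t t - H (h (b none) (b none)) t := by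
    have := congrArg (fun w => H w t) ht
    simp at this
    simp
    linarith
  rw [e1, e2, sumSq_option hsymm]
  simp [hH.symm t]
  ring

variable [FiniteDimensional ℝ V]

theorem IsInnerForm.sumSq_eq (hB : IsInnerForm B)
    {e : ι → V} (he : IsOrthonormal (fun v w => B v w) e)
    (hcard : Module.finrank ℝ V = Fintype.card ι)
    {e' : κ → V} (he' : IsOrthonormal (fun v w => B v w) e')
    (hcard' : Module.finrank ℝ V = Fintype.card κ) : sumSq H h e = sumSq H h e' := by
  unfold sumSq
  rw [Finset.sum_comm]
  have h1 : ∀ w, ∑ i, H (h (e i) w) (h (e i) w) = ∑ i, H (h (e' i) w) (h (e' i) w) := fun w =>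
    hB.sum_bilin_eq he hcard he' hcard' (H.compl₁₂ (h.flip w) (h.flip w))
  have h2 : ∀ w, ∑ i, H (h w (e i)) (h w (e i)) = ∑ i, H (h w (e' i)) (h w (e' i)) := fun w =>
    hB.sum_bilin_eq he hcard he' hcard' (H.compl₁₂ (h w) (h w))
  simp only [h1]
  rw [Finset.sum_comm]
  simp only [h2]

/-- Rewrites the norm on a hyperplane in one fixed basis, so that only the unit normal varies and
the supremum becomes a maximum over the sphere. -/
theorem IsInnerForm.sumSq_some_eq (hB : IsInnerForm B) (hsymm : ∀ u v, h u v = h v u)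
    {e : ι → V} (he : IsOrthonormal (fun v w => B v w) e)
    (hcard : Module.finrank ℝ V = Fintype.card ι)
    {b : Option κ → V} (hb : IsOrthonormal (fun v w => B v w) b)
    (hcard' : Module.finrank ℝ V = Fintype.card (Option κ)) :
    sumSq H h (fun i => b (some i)) = hyperplaneSq H h e (b none) := by
  have h1 : ∑ i, H (h (e i) (b none)) (h (e i) (b none)) =
      ∑ i, H (h (b i) (b none)) (h (b i) (b none)) :=
    hB.sum_bilin_eq he hcard hb hcard' (H.compl₁₂ (h.flip (b none)) (h.flip (b none)))
  rw [hyperplaneSq, hB.sumSq_eq he hcard hb hcard', h1, sumSq_option hsymm, Fintype.sum_option]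
  ring

theorem IsInnerForm.quasiUmbilical_of_basis (hB : IsInnerForm B)
    {e : ι → V} (he : IsOrthonormal (fun v w => B v w) e)
    (hcard : Module.finrank ℝ V = Fintype.card ι) {a : V} {η : W}
    (hmodel : ∀ i j, h (e i) (e j) = (2 * B (e i) (e j) - B (e i) a * B (e j) a) • η) (u v : V) :
    h u v = (2 * B u v - B u a * B v a) • η := by
  rw [← hB.sum_smul he hcard u, ← hB.sum_smul he hcard v]
  simp only [map_sum, map_smul, LinearMap.sum_apply, LinearMap.smul_apply, hmodel, smul_smul,
    ← Finset.sum_smul, smul_eq_mul]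
  congr 1
  simp only [Finset.mul_sum, Finset.sum_mul, ← Finset.sum_sub_distrib]
  refine Finset.sum_congr rfl fun i _ => Finset.sum_congr rfl fun j _ => ?_
  ring

/-- The algebraic inequality behind the Casorati bound, for the hyperplane orthogonal to `ν`,
with its equality case. -/
theorem IsInnerForm.trace_sq_le (hB : IsInnerForm B) (hH : IsInnerForm H)
    (hsymm : ∀ u v, h u v = h v u) {n : ℕ} (hn : Module.finrank ℝ V = n)
    {e : ι → V} (he : IsOrthonormal (fun v w => B v w) e) (hcard : Fintype.card ι = n)
    {ν : V} (hν : B ν ν = 1) :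
    H (∑ i, h (e i) (e i)) (∑ i, h (e i) (e i)) ≤
      (2 * n - 1) * (sumSq H h e - hyperplaneSq H h e ν / 2) ∧
    (H (∑ i, h (e i) (e i)) (∑ i, h (e i) (e i)) =
      (2 * n - 1) * (sumSq H h e - hyperplaneSq H h e ν / 2) →
      ∀ u v, h u v = (2 * B u v - B u ν * B v ν) • h ν ν) := by
  have hne : ν ≠ 0 := by rintro rfl; simp at hν
  have hn0 : 0 < n := by
    rw [← hn]; exact Module.finrank_pos_iff_exists_ne_zero.2 ⟨ν, hne⟩
  obtain ⟨k, rfl⟩ : ∃ k, n = k + 1 := ⟨n - 1, by omega⟩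
  have hcard' : Module.finrank ℝ V = Fintype.card (Option (Fin k)) := by simp [hn]
  have hcardι : Module.finrank ℝ V = Fintype.card ι := by rw [hn, hcard]
  obtain ⟨b, hb, hbν⟩ := hB.exists_isOrthonormal_extension hcard' (fun _ => ν) {none}
    (by simp [hν])
  have hbν : b none = ν := hbν none rfl
  have hpos : (0 : ℝ) < 2 * (Fintype.card (Fin k) : ℝ) + 1 := by positivity
  obtain ⟨t, ht⟩ : ∃ t, ∑ i, h (b i) (b i) = (2 * (Fintype.card (Fin k) : ℝ) + 1) • t :=
    ⟨(2 * (Fintype.card (Fin k) : ℝ) + 1)⁻¹ • ∑ i, h (b i) (b i), by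
      rw [smul_smul, mul_inv_cancel₀ hpos.ne', one_smul]⟩
  have key := sumSq_sub_eq_sum_sq hH hsymm b t ht
  rw [hB.sumSq_some_eq hsymm he hcardι hb hcard', hB.sumSq_eq hb hcard' he hcardι, hbν] at key
  rw [hB.sum_bilin_eq he hcardι hb hcard' h, ht]
  simp only [Fintype.card_fin, map_smul, LinearMap.smul_apply, smul_eq_mul] at *
  push_cast
  have hN : 2 * ((k : ℝ) + 1) - 1 = 2 * k + 1 := by ring
  rw [hN]
  have n1 : 0 ≤ ∑ i, ∑ j, H (h (b (some i)) (b (some j)) - (if i = j then (2 : ℝ) else 0) • t)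
        (h (b (some i)) (b (some j)) - (if i = j then (2 : ℝ) else 0) • t) :=
    Finset.sum_nonneg fun i _ => Finset.sum_nonneg fun j _ => hH.nonneg _
  have n2 : 0 ≤ ∑ i, H (h (b (some i)) ν) (h (b (some i)) ν) :=
    Finset.sum_nonneg fun i _ => hH.nonneg _
  have n3 := hH.nonneg (h ν ν - t)
  refine ⟨mul_le_mul_of_nonneg_left (by linarith) hpos.le, fun heq => ?_⟩
  have heq := mul_left_cancel₀ hpos.ne' heq
  have z1 : ∑ i, ∑ j, H (h (b (some i)) (b (some j)) - (if i = j then (2 : ℝ) else 0) • t)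
        (h (b (some i)) (b (some j)) - (if i = j then (2 : ℝ) else 0) • t) = 0 := by linarith
  have z2 : ∑ i, H (h (b (some i)) ν) (h (b (some i)) ν) = 0 := by linarith
  have z3 : h ν ν = t := sub_eq_zero.1 (hH.eq_zero (by linarith))
  have z2' : ∀ i, h (b (some i)) ν = 0 := fun i => hH.eq_zero
    ((Finset.sum_eq_zero_iff_of_nonneg fun i _ => hH.nonneg _).1 z2 i (Finset.mem_univ i))
  have z1' : ∀ i j, h (b (some i)) (b (some j)) = (if i = j then (2 : ℝ) else 0) • t := by
    intro i j
    have := (Finset.sum_eq_zero_iff_of_nonneg fun i _ =>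
      Finset.sum_nonneg fun j _ => hH.nonneg _).1 z1 i (Finset.mem_univ i)
    exact sub_eq_zero.1 (hH.eq_zero ((Finset.sum_eq_zero_iff_of_nonneg fun j _ =>
      hH.nonneg _).1 this j (Finset.mem_univ j)))
  have hb' : ∀ i j, B (b i) (b j) = if i = j then 1 else 0 := hb
  have hmodel : ∀ i j, h (b i) (b j) = (2 * B (b i) (b j) - B (b i) ν * B (b j) ν) • t := by
    rw [← hbν] at z2' z3 ⊢
    rintro (_ | i) (_ | j)
    · rw [z3]; simp only [hb']; norm_num
    · rw [hsymm, z2']; simp [hb']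
    · rw [z2']; simp [hb']
    · rw [z1']; simp only [hb']; simp
  intro u v
  rw [z3]
  exact hB.quasiUmbilical_of_basis hb hcard' hmodel u v

/-- With P the projection onto the line of `a`, this is (2I - P)² = 4I - 3P. -/
theorem IsInnerForm.sum_sq_of_quasiUmbilical (hB : IsInnerForm B) {a : V} (ha : B a a = 1) {η : W}
    (hmodel : ∀ u v, h u v = (2 * B u v - B u a * B v a) • η)
    {e : ι → V} (he : IsOrthonormal (fun v w => B v w) e)
    (hcard : Module.finrank ℝ V = Fintype.card ι) (w : V) :
    ∑ i, H (h (e i) w) (h (e i) w) = (4 * B w w - 3 * B w a ^ 2) * H η η := by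
  have h1 : ∀ i, H (h (e i) w) (h (e i) w) = (4 * (B (e i) w * B (e i) w) -
      4 * B w a * (B (e i) w * B (e i) a) + B w a ^ 2 * (B (e i) a * B (e i) a)) * H η η := by
    intro i
    rw [hmodel]
    simp
    ring
  simp only [h1, ← Finset.sum_mul, Finset.sum_add_distrib, Finset.sum_sub_distrib,
    ← Finset.mul_sum, hB.sum_mul he hcard, ha]
  ring

/-- The equality case: for a quasi-umbilical `h` with eigenvalue ratio two, the hyperplane
orthogonal to the distinguished direction is extremal and the trace inequality is an equality. -/
theorem IsInnerForm.trace_sq_eq_of_quasiUmbilical (hB : IsInnerForm B) (hH : IsInnerForm H)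
    {n : ℕ} (hn : Module.finrank ℝ V = n)
    {e : ι → V} (he : IsOrthonormal (fun v w => B v w) e) (hcard : Fintype.card ι = n)
    {a : V} (ha : B a a = 1) {η : W}
    (hmodel : ∀ u v, h u v = (2 * B u v - B u a * B v a) • η) :
    (∀ ν, B ν ν = 1 → hyperplaneSq H h e ν ≤ hyperplaneSq H h e a) ∧
    H (∑ i, h (e i) (e i)) (∑ i, h (e i) (e i)) =
      (2 * n - 1) * (sumSq H h e - hyperplaneSq H h e a / 2) := by
  have hcardι : Module.finrank ℝ V = Fintype.card ι := by rw [hn, hcard]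
  have he' : ∀ i, B (e i) (e i) = 1 := fun i => by simpa using he i i
  have hcol := fun w => hB.sum_sq_of_quasiUmbilical (H := H) ha hmodel he hcardι w
  have hη := hH.nonneg η
  refine ⟨fun ν hν => ?_, ?_⟩
  · have hs : B ν a ^ 2 ≤ 1 := by
      have := hB.nonneg (ν - B ν a • a)
      simp [ha, hν, hB.symm a ν] at this
      nlinarith
    have e1 : ∀ ν, B ν ν = 1 → H (h ν ν) (h ν ν) = (2 - B ν a ^ 2) ^ 2 * H η η := by
      intro ν hν
      rw [hmodel]
      simp [hν]
      ring
    simp only [hyperplaneSq, hcol]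
    rw [e1 ν hν, e1 a ha, ha, hν]
    -- With s = g(ν, a)², the value at ν is S + (s² + 2s - 4)|η|²; this product is the gap to the
    -- value at s = 1.
    have : 0 ≤ (1 - B ν a ^ 2) * (B ν a ^ 2 + 3) * H η η :=
      mul_nonneg (mul_nonneg (by linarith) (by positivity)) hη
    nlinarith
  · have hS : sumSq H h e = (4 * n - 3) * H η η := by
      rw [sumSq, Finset.sum_comm]
      simp only [hcol, he', ← Finset.sum_mul, Finset.sum_sub_distrib, pow_two,
        ← Finset.mul_sum, hB.sum_mul he hcardι, ha]
      simp only [Finset.sum_const, Finset.card_univ, hcard, nsmul_eq_mul]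
      ring
    have hT : ∑ i, h (e i) (e i) = (2 * (n : ℝ) - 1) • η := by
      simp only [hmodel, he', ← Finset.sum_smul, Finset.sum_sub_distrib,
        hB.sum_mul he hcardι, ha]
      simp [hcard, mul_comm]
    have haa : h a a = η := by rw [hmodel, ha]; norm_num
    rw [hyperplaneSq, hcol, hS, hT, ha, haa]
    simp only [map_smul, LinearMap.smul_apply, smul_eq_mul]
    ring

/-- Some hyperplane maximizes the norm of the restriction of `h`. -/
theorem IsInnerForm.exists_hyperplaneSq_max {ι : Type*} [Fintype ι] [Nontrivial V]
    (hB : IsInnerForm B) (hH : IsInnerForm H) (e : ι → V) :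
    ∃ ν, B ν ν = 1 ∧ ∀ ν', B ν' ν' = 1 → hyperplaneSq H h e ν' ≤ hyperplaneSq H h e ν := by
  let _ : NormedAddCommGroup V := hB.core.toNormedAddCommGroup
  let _ : InnerProductSpace ℝ V := InnerProductSpace.ofCore hB.core.toCore
  let _ : NormedAddCommGroup W := hH.core.toNormedAddCommGroup
  let _ : InnerProductSpace ℝ W := InnerProductSpace.ofCore hH.core.toCore
  have hinner : ∀ v : V, B v v = ‖v‖ ^ 2 := fun v => (real_inner_self_eq_norm_sq v)
  have hnorm : ∀ w : W, H w w = ‖w‖ ^ 2 := fun w => (real_inner_self_eq_norm_sq w)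
  let h' : V →ₗ[ℝ] V →L[ℝ] W :=
    (LinearMap.toContinuousLinearMap : (V →ₗ[ℝ] W) ≃ₗ[ℝ] V →L[ℝ] W).toLinearMap ∘ₗ h
  have hh' : ∀ u v, h u v = h' u v := fun _ _ => rfl
  have hc : Continuous h' := LinearMap.continuous_of_finiteDimensional h'
  have hcont : Continuous (hyperplaneSq H h e) := by
    unfold hyperplaneSq
    simp only [hnorm, hh']
    refine (continuous_const.sub (continuous_const.mul (continuous_finsetSum _ fun i _ =>
      ((h' (e i)).continuous.norm.pow 2)))).add ((hc.clm_apply continuous_id).norm.pow 2)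
  -- A continuous function on the compact unit sphere of the finite-dimensional `V` attains its
  -- maximum.
  obtain ⟨ν, hν, hmax⟩ := (isCompact_sphere (0 : V) 1).exists_isMaxOn
    (NormedSpace.sphere_nonempty.2 zero_le_one) hcont.continuousOn
  refine ⟨ν, ?_, fun ν' hν' => hmax ?_⟩
  · rw [hinner, mem_sphere_zero_iff_norm.1 hν, one_pow]
  · rw [hinner] at hν'
    rw [mem_sphere_zero_iff_norm]
    nlinarith [norm_nonneg ν']

end SecondFundamentalForms

/-! ### Geometry at a point: curvature and ideal second fundamental forms. -/

section PointwiseGeometry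

/-- Curvature depends only on the germ of the metric; this allows the chart metric to be replaced by
the induced one. -/
theorem riemannCoord_congr {F : Type*} [NormedAddCommGroup F] [NormedSpace ℝ F]
    {G G' : F → F →L[ℝ] F →L[ℝ] ℝ} {y : F} (h : G =ᶠ[𝓝 y] G') (u v w : F) :
    riemannCoord G y u v w = riemannCoord G' y u v w := by
  have hΓ : christoffel G =ᶠ[𝓝 y] christoffel G' := by
    filter_upwards [h, h.fderiv (𝕜 := ℝ)] with z h1 h2
    simp only [christoffel, christoffelFirst, h1, h2]
  have hcov : ∀ v, covDerivAlong G id v (fun _ => w) =ᶠ[𝓝 y]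
      covDerivAlong G' id v (fun _ => w) := by
    intro v
    filter_upwards [hΓ] with z hz
    simp only [covDerivAlong, id, hz]
  have hcov2 : ∀ u v, covDerivAlong G id u (covDerivAlong G id v (fun _ => w)) y =
      covDerivAlong G' id u (covDerivAlong G' id v (fun _ => w)) y := by
    intro u v
    rw [covDerivAlong, (hcov v).fderiv_eq, (hcov v).eq_of_nhds, id, hΓ.eq_of_nhds]
    rfl
  simp only [riemannCoord, hcov2]

/-- The scalar product of a metric at a point. -/
def metricForm {m : ℕ} {M : Type*} [TopologicalSpace M]
    [ChartedSpace (EuclideanSpace ℝ (Fin m)) M] [IsManifold (𝓡 m) ∞ M] (g : Metric m M) (x : M) :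
    TangentSpace (𝓡 m) x →ₗ[ℝ] TangentSpace (𝓡 m) x →ₗ[ℝ] ℝ :=
  LinearMap.mk₂ ℝ (fun v w => g.inner x v w) (by simp) (by simp) (by simp) (by simp)

variable {n d : ℕ}
  {M : Type*} [TopologicalSpace M] [ChartedSpace (EuclideanSpace ℝ (Fin n)) M]
  {N : Type*} [TopologicalSpace N] [ChartedSpace (EuclideanSpace ℝ (Fin d)) N]
  [IsManifold (𝓡 d) ∞ N] {gN : Metric d N} {φ : M → N}

instance finiteDimensional_tangentSpace (x : M) : FiniteDimensional ℝ (TangentSpace (𝓡 n) x) :=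
  inferInstanceAs (FiniteDimensional ℝ (EuclideanSpace ℝ (Fin n)))

theorem finrank_tangentSpace (x : M) : Module.finrank ℝ (TangentSpace (𝓡 n) x) = n :=
  finrank_euclideanSpace_fin (𝕜 := ℝ) (n := n)

/-- The second fundamental form at a point as a bilinear map. -/
def secondFundForm (gN : Metric d N) (φ : M → N) (x : M) :
    TangentSpace (𝓡 n) x →ₗ[ℝ] TangentSpace (𝓡 n) x →ₗ[ℝ] TangentSpace (𝓡 d) (φ x) :=
  LinearMap.mk₂ ℝ (secondFund gN φ x)
    (fun u u' v => DFunLike.congr_fun (map_add (secondFundCoord (chartMetric gN (φ x))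
      (writtenInExtChartAt (𝓡 n) (𝓡 d) x φ) (extChartAt (𝓡 n) x x)) u u') v)
    (fun a u v => DFunLike.congr_fun (map_smul (secondFundCoord (chartMetric gN (φ x))
      (writtenInExtChartAt (𝓡 n) (𝓡 d) x φ) (extChartAt (𝓡 n) x x)) a u) v)
    (fun u v v' => map_add (secondFundCoord (chartMetric gN (φ x))
      (writtenInExtChartAt (𝓡 n) (𝓡 d) x φ) (extChartAt (𝓡 n) x x) u) v v')
    (fun a u v => map_smul (secondFundCoord (chartMetric gN (φ x))
      (writtenInExtChartAt (𝓡 n) (𝓡 d) x φ) (extChartAt (𝓡 n) x x) u) a v)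

theorem chartMetric_writtenInExtChartAt (gN : Metric d N) (φ : M → N) (x : M)
    (u v : TangentSpace (𝓡 d) (φ x)) :
    chartMetric gN (φ x) (writtenInExtChartAt (𝓡 n) (𝓡 d) x φ (extChartAt (𝓡 n) x x)) u v =
      metricForm gN (φ x) u v := by
  rw [writtenInExtChartAt_self]
  exact chartMetric_self gN (φ x) u v

variable [IsManifold (𝓡 n) ∞ M] {g : Metric n M}

theorem isInnerForm_metricForm (g : Metric n M) (x : M) : IsInnerForm (metricForm g x) where
  symm v w := g.symm x v w
  pos v hv := g.pos x v hv

theorem IsIsometricImmersion.inducedMetric_eq (h : IsIsometricImmersion g gN φ) (x : M)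
    (u v : TangentSpace (𝓡 n) x) :
    inducedMetric (chartMetric gN (φ x)) (writtenInExtChartAt (𝓡 n) (𝓡 d) x φ)
      (extChartAt (𝓡 n) x x) u v = metricForm g x u v := by
  rw [← (h.chartMetric_eventuallyEq x).eq_of_nhds]
  exact chartMetric_self g x u v

theorem IsIsometricImmersion.secondFundForm_symm (h : IsIsometricImmersion g gN φ) (x : M)
    (u v : TangentSpace (𝓡 n) x) : secondFundForm gN φ x u v = secondFundForm gN φ x v u :=
  (h.isImmersionNear x).secondFundCoord_symm u v

theorem IsIsometricImmersion.inner_secondFundForm_mfderiv (h : IsIsometricImmersion g gN φ) (x : M)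
    (u v w : TangentSpace (𝓡 n) x) :
    metricForm gN (φ x) (secondFundForm gN φ x u v) (mfderiv (𝓡 n) (𝓡 d) φ x w) = 0 := by
  have := (h.isImmersionNear x).inner_secondFundCoord_fderiv u v w
  rw [h.fderiv_eq] at this
  exact (chartMetric_writtenInExtChartAt gN φ x _ _).symm.trans this

theorem IsIsometricImmersion.inner_shapeOperator (h : IsIsometricImmersion g gN φ) (x : M)
    (ξ : TangentSpace (𝓡 d) (φ x)) (u v : TangentSpace (𝓡 n) x) :
    metricForm g x (shapeOperator gN φ x ξ u) v =
      metricForm gN (φ x) (secondFundForm gN φ x u v) ξ :=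
  (h.inducedMetric_eq x _ _).symm.trans
    (((h.isImmersionNear x).inducedMetric_shapeCoord ξ u v).trans
      (chartMetric_writtenInExtChartAt gN φ x _ _))

theorem IsRealSpaceForm.inner_riemannCoord {c : ℝ} (hN : IsRealSpaceForm gN c) (x : N)
    (u v w z : EuclideanSpace ℝ (Fin d)) :
    chartMetric gN x (extChartAt (𝓡 d) x x)
      (riemannCoord (chartMetric gN x) (extChartAt (𝓡 d) x x) u v w) z =
      c * (chartMetric gN x (extChartAt (𝓡 d) x x) v w * chartMetric gN x (extChartAt (𝓡 d) x x) u z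
        - chartMetric gN x (extChartAt (𝓡 d) x x) u w *
          chartMetric gN x (extChartAt (𝓡 d) x x) v z) := by
  refine (isMetricNear_chartMetric gN x).inner_riemannCoord_of_sectional_eq (fun u v huv => ?_)
    u v w z
  refine Eq.trans ?_ (hN x u v huv)
  have e := fun a b => chartMetric_self gN x a b
  exact congrArg₂ (· / ·) (e _ _) (congrArg₂ (· - ·) (congrArg₂ (· * ·) (e _ _) (e _ _))
    (congrArg (· ^ 2) (e _ _)))

/-- Sectional curvatures of a submanifold of a space form, by the Gauss equation. -/
theorem IsIsometricImmersion.sectionalCurvature_eq (h : IsIsometricImmersion g gN φ) {c : ℝ}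
    (hN : IsRealSpaceForm gN c) (x : M) (u v : TangentSpace (𝓡 n) x)
    (hu : metricForm g x u u = 1) (hv : metricForm g x v v = 1) (huv : metricForm g x u v = 0) :
    sectionalCurvature g x u v = c +
      metricForm gN (φ x) (secondFundForm gN φ x u u) (secondFundForm gN φ x v v) -
      metricForm gN (φ x) (secondFundForm gN φ x u v) (secondFundForm gN φ x u v) := by
  have hG := chartMetric_writtenInExtChartAt (n := n) gN φ x
  have hI := h.isImmersionNear x
  have hg := h.inducedMetric_eq x
  have gauss := hI.gauss u v v u
  have hR : riemann g x u v v = riemannCoord (inducedMetric (chartMetric gN (φ x))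
      (writtenInExtChartAt (𝓡 n) (𝓡 d) x φ)) (extChartAt (𝓡 n) x x) u v v :=
    riemannCoord_congr (h.chartMetric_eventuallyEq x) u v v
  have hsf := hN.inner_riemannCoord (φ x)
  rw [← writtenInExtChartAt_self (n := n) φ x] at hsf
  rw [hsf] at gauss
  have hvu : metricForm g x v u = 0 := by rw [(isInnerForm_metricForm g x).symm, huv]
  have e1 := (hg u u).trans hu
  have e2 := (hg v v).trans hv
  have e3 := (hg u v).trans huv
  have e4 := (hg v u).trans hvu
  have e5 := hg (riemann g x u v v) u
  rw [hR] at e5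
  have e6 := hG (secondFundForm gN φ x v v) (secondFundForm gN φ x u u)
  have e7 := hG (secondFundForm gN φ x u v) (secondFundForm gN φ x v u)
  have e8 : metricForm g x (riemann g x u v v) u =
      c * (1 * 1 - 0 * 0) + metricForm gN (φ x) (secondFundForm gN φ x v v)
        (secondFundForm gN φ x u u) -
      metricForm gN (φ x) (secondFundForm gN φ x u v) (secondFundForm gN φ x v u) := by
    rw [hR]
    refine e5.symm.trans (gauss.trans ?_)
    refine congrArg₂ (· - ·) (congrArg₂ (· + ·) ?_ e6) e7
    exact congrArg (c * ·) (congrArg₂ (· - ·) (congrArg₂ (· * ·) e2 e1) (congrArg₂ (· * ·) e3 e4))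
  rw [h.secondFundForm_symm x v u, (isInnerForm_metricForm gN (φ x)).symm
    (secondFundForm gN φ x v v)] at e8
  have e9 : sectionalCurvature g x u v = metricForm g x (riemann g x u v v) u /
    (metricForm g x u u * metricForm g x v v - metricForm g x u v ^ 2) := rfl
  rw [e9, e8, hu, hv, huv]
  ring

/-- The second fundamental form is `(u, v) ↦ (2 g(u, v) - g(u, a) g(v, a)) η` for some unit
vector `a`. -/
def IsIdealForm (g : Metric n M) (gN : Metric d N) (φ : M → N) (x : M) : Prop :=
  ∃ (a : TangentSpace (𝓡 n) x) (η : TangentSpace (𝓡 d) (φ x)), metricForm g x a a = 1 ∧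
    ∀ u v, secondFundForm gN φ x u v =
      (2 * metricForm g x u v - metricForm g x u a * metricForm g x v a) • η

theorem IsIsometricImmersion.shapeOperator_of_idealForm (h : IsIsometricImmersion g gN φ) {x : M}
    {a : TangentSpace (𝓡 n) x} {η : TangentSpace (𝓡 d) (φ x)}
    (hmodel : ∀ u v, secondFundForm gN φ x u v =
      (2 * metricForm g x u v - metricForm g x u a * metricForm g x v a) • η)
    (ξ : TangentSpace (𝓡 d) (φ x)) (u : TangentSpace (𝓡 n) x) :
    shapeOperator gN φ x ξ u =
      metricForm gN (φ x) η ξ • ((2 : ℝ) • u - metricForm g x u a • a) := by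
  have hB := isInnerForm_metricForm g x
  refine sub_eq_zero.1 (hB.eq_zero ?_)
  have : ∀ w, metricForm g x (shapeOperator gN φ x ξ u -
      metricForm gN (φ x) η ξ • ((2 : ℝ) • u - metricForm g x u a • a)) w = 0 := by
    intro w
    rw [map_sub, LinearMap.sub_apply, h.inner_shapeOperator, hmodel]
    simp only [map_smul, map_sub, LinearMap.smul_apply, LinearMap.sub_apply, smul_eq_mul,
      hB.symm a w]
    ring
  exact this _

/-- In the Ricci equation the ambient term vanishes, because constant curvature makes R(u, v)ξ = 0
for ξ normal to u and v. The rest cancels because every shape operator is a multiple of 2I - a ⊗ a,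
so all of them commute. -/
theorem IsIsometricImmersion.normalFlatAt_of_idealForm (h : IsIsometricImmersion g gN φ) {c : ℝ}
    (hN : IsRealSpaceForm gN c) {x : M} (hx : IsIdealForm g gN φ x) :
    NormalFlatAt (n := n) gN φ x := by
  obtain ⟨a, η, ha, hmodel⟩ := hx
  intro ξ hξ hn u v
  have hI := h.isImmersionNear x
  rw [hI.ricci (hξ.of_le ENat.LEInfty.out) hn]
  have hR : riemannCoord (chartMetric gN (φ x))
      (writtenInExtChartAt (𝓡 n) (𝓡 d) x φ (extChartAt (𝓡 n) x x))
      (fderiv ℝ (writtenInExtChartAt (𝓡 n) (𝓡 d) x φ) (extChartAt (𝓡 n) x x) u)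
      (fderiv ℝ (writtenInExtChartAt (𝓡 n) (𝓡 d) x φ) (extChartAt (𝓡 n) x x) v)
      (ξ (extChartAt (𝓡 n) x x)) = 0 := by
    refine hI.metric.eq_of_forall fun w => ?_
    have hsf := hN.inner_riemannCoord (φ x)
    rw [← writtenInExtChartAt_self (n := n) φ x] at hsf
    rw [hsf, hn.self_of_nhds, hn.self_of_nhds]
    simp
  have hsymm : ∀ (ζ : TangentSpace (𝓡 d) (φ x)) (u v : TangentSpace (𝓡 n) x),
      secondFundForm gN φ x u (shapeOperator gN φ x ζ v) =
      secondFundForm gN φ x v (shapeOperator gN φ x ζ u) := by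
    intro ζ u v
    rw [h.shapeOperator_of_idealForm hmodel, h.shapeOperator_of_idealForm hmodel]
    simp only [map_smul, map_sub, LinearMap.smul_apply, LinearMap.sub_apply, smul_eq_mul, hmodel,
      ha, (isInnerForm_metricForm g x).symm v u]
    module
  rw [hR, map_zero, zero_add]
  exact sub_eq_zero.2 (hsymm _ u v)

theorem IsIsometricImmersion.invariantlyQuasiUmbilicalAt_of_idealForm
    (h : IsIsometricImmersion g gN φ) {p : ℕ} {x : M} (hx : IsIdealForm g gN φ x)
    {ξ : Fin p → TangentSpace (𝓡 d) (φ x)} (hξ : IsNormalFrame (n := n) gN φ x ξ) :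
    InvariantlyQuasiUmbilicalAt p g gN φ x := by
  obtain ⟨a, η, ha, hmodel⟩ := hx
  refine ⟨ξ, hξ, a, by rintro rfl; simp at ha, fun r =>
    ⟨2 * metricForm gN (φ x) η (ξ r), metricForm gN (φ x) η (ξ r), ?_, fun v hv => ?_⟩⟩
  · rw [h.shapeOperator_of_idealForm hmodel, ha]
    module
  · have hv : metricForm g x v a = 0 := hv
    rw [h.shapeOperator_of_idealForm hmodel, hv]
    module

end PointwiseGeometry

/-! ### Ideal forms and adapted frames. -/

section Equality

variable {n p : ℕ}
  {M : Type*} [TopologicalSpace M] [ChartedSpace (EuclideanSpace ℝ (Fin n)) M]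
  [IsManifold (𝓡 n) ∞ M]
  {N : Type*} [TopologicalSpace N] [ChartedSpace (EuclideanSpace ℝ (Fin (n + p))) N]
  [IsManifold (𝓡 (n + p)) ∞ N] {g : Metric n M} {gN : Metric (n + p) N} {φ : M → N}

/-- With n + p members the joint family is a basis of the ambient tangent space, so h can be
recovered from its normal components. -/
theorem IsIsometricImmersion.isOrthonormal_sumElim (h : IsIsometricImmersion g gN φ) {x : M}
    {e : Fin n → TangentSpace (𝓡 n) x} (he : IsOrthonormal (fun v w => metricForm g x v w) e)
    {ξ : Fin p → TangentSpace (𝓡 (n + p)) (φ x)} (hξ : IsNormalFrame (n := n) gN φ x ξ) :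
    IsOrthonormal (fun v w => metricForm gN (φ x) v w)
      (Sum.elim (fun i => mfderiv (𝓡 n) (𝓡 (n + p)) φ x (e i)) ξ) := by
  rintro (i | r) (j | s)
  · refine (h.isometric x (e i) (e j)).trans ((he i j).trans ?_)
    simp
  · simpa using! hξ.2 s (e i)
  · simpa using ((isInnerForm_metricForm gN (φ x)).symm _ _).trans (hξ.2 r (e j))
  · simpa using! hξ.1 r s

theorem IsIsometricImmersion.isIdealForm_of_idealShapeAt (h : IsIsometricImmersion g gN φ)
    (hn : 0 < n) {x : M} (hx : IdealShapeAt p g gN φ x) : IsIdealForm g gN φ x := by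
  obtain ⟨e, ξ, lam, he, hξ, hA⟩ := hx
  have hB := isInnerForm_metricForm g x
  have hH := isInnerForm_metricForm gN (φ x)
  have he : ∀ i j, metricForm g x (e i) (e j) = if i = j then 1 else 0 := he
  have hcard : Module.finrank ℝ (TangentSpace (𝓡 n) x) = Fintype.card (Fin n) := by
    rw [finrank_tangentSpace, Fintype.card_fin]
  have hcard' : Module.finrank ℝ (TangentSpace (𝓡 (n + p)) (φ x)) =
      Fintype.card (Fin n ⊕ Fin p) := by
    rw [finrank_tangentSpace]; simp
  -- The distinguished direction is the last frame vector. The sum equals ξ₀ when p > 0 and 0 when p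
  -- = 0, so both cases are covered at once.
  refine ⟨e ⟨n - 1, by omega⟩, lam • ∑ r : Fin p, if (r : ℕ) = 0 then ξ r else 0, by simp [he],
    hB.quasiUmbilical_of_basis he hcard fun j i => ?_⟩
  rw [← hH.sum_smul (h.isOrthonormal_sumElim he hξ) hcard' (secondFundForm gN φ x (e j) (e i)),
    Fintype.sum_sum_type]
  simp only [Sum.elim_inl, Sum.elim_inr, h.inner_secondFundForm_mfderiv, zero_smul,
    Finset.sum_const_zero, zero_add, Finset.smul_sum]
  refine Finset.sum_congr rfl fun r _ => ?_
  have hr : metricForm gN (φ x) (secondFundForm gN φ x (e j) (e i)) (ξ r) = _ :=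
    (h.inner_shapeOperator x (ξ r) (e j) (e i)).symm.trans (congrFun (congrFun (hA r) i) j)
  rw [hr]
  split_ifs with h0
  · rw [Matrix.diagonal_apply, he, he, he, smul_smul]
    congr 1
    simp only [Fin.ext_iff]
    split_ifs <;> first | omega | ring
  · simp

theorem IsIsometricImmersion.idealShapeAt_of_isIdealForm (h : IsIsometricImmersion g gN φ)
    (hn : 0 < n) {x : M} (hx : IsIdealForm g gN φ x) : IdealShapeAt p g gN φ x := by
  obtain ⟨a, η, ha, hmodel⟩ := hx
  have hB := isInnerForm_metricForm g x
  have hH := isInnerForm_metricForm gN (φ x)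
  have hcard : Module.finrank ℝ (TangentSpace (𝓡 n) x) = Fintype.card (Fin n) := by
    rw [finrank_tangentSpace, Fintype.card_fin]
  have hcard' : Module.finrank ℝ (TangentSpace (𝓡 (n + p)) (φ x)) =
      Fintype.card (Fin n ⊕ Fin p) := by
    rw [finrank_tangentSpace]; simp
  obtain ⟨e, he, hea⟩ := hB.exists_isOrthonormal_extension hcard (fun _ => a) {⟨n - 1, by omega⟩}
    (by simp [ha])
  have he : ∀ i j, metricForm g x (e i) (e j) = if i = j then 1 else 0 := he
  have hea : e ⟨n - 1, by omega⟩ = a := hea _ rfl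
  have hη : η = secondFundForm gN φ x a a := by rw [hmodel, ha]; norm_num
  have hηn : ∀ u, metricForm gN (φ x) η (mfderiv (𝓡 n) (𝓡 (n + p)) φ x u) = 0 := fun u => by
    rw [hη, h.inner_secondFundForm_mfderiv]
  set lam := Real.sqrt (metricForm gN (φ x) η η) with hlam
  have hlam2 : metricForm gN (φ x) η η = lam * lam := (Real.mul_self_sqrt (hH.nonneg η)).symm
  have hlam0 : η ≠ 0 → lam ≠ 0 := fun h0 h1 => h0 (hH.eq_zero (by rw [hlam2, h1, zero_mul]))
  -- Prescribe the images of the tangent frame and, if η ≠ 0, the first normal vector η/|η|; if η =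
  -- 0 any completion works, with λ = 0.
  obtain ⟨b, hb, hbs⟩ := hH.exists_isOrthonormal_extension hcard'
    (Sum.elim (fun i => mfderiv (𝓡 n) (𝓡 (n + p)) φ x (e i)) (fun _ => lam⁻¹ • η))
    {k | (∃ i, k = Sum.inl i) ∨ η ≠ 0 ∧ ∃ r : Fin p, (r : ℕ) = 0 ∧ k = Sum.inr r} (by
      rintro _ (⟨i, rfl⟩ | ⟨h0, r, hr, rfl⟩) _ (⟨j, rfl⟩ | ⟨h0', s, hs, rfl⟩)
      · refine (h.isometric x (e i) (e j)).trans ((he i j).trans ?_)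
        simp
      · simp [hH.symm _ η, hηn]
      · simp [hηn]
      · have hl := hlam0 h0
        have : r = s := Fin.ext (hr.trans hs.symm)
        simp [this, hlam2, hl])
  have hb : ∀ i j, metricForm gN (φ x) (b i) (b j) = if i = j then 1 else 0 := hb
  have hbl : ∀ i, b (Sum.inl i) = mfderiv (𝓡 n) (𝓡 (n + p)) φ x (e i) :=
    fun i => hbs _ (Or.inl ⟨i, rfl⟩)
  have hηξ : ∀ r : Fin p, metricForm gN (φ x) η (b (Sum.inr r)) =
      if (r : ℕ) = 0 then lam else 0 := by
    intro r
    by_cases h0 : η = 0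
    · simp [hlam, h0]
    · have hl := hlam0 h0
      have hp : 0 < p := r.pos
      have hb0 : b (Sum.inr ⟨0, hp⟩) = lam⁻¹ • η := hbs _ (Or.inr ⟨h0, ⟨0, hp⟩, rfl, rfl⟩)
      have hη' : η = lam • b (Sum.inr ⟨0, hp⟩) := by
        rw [hb0, smul_smul, mul_inv_cancel₀ hl, one_smul]
      conv_lhs => rw [hη']
      rw [map_smul, LinearMap.smul_apply, hb]
      simp [Fin.ext_iff, eq_comm]
  refine ⟨e, fun r => b (Sum.inr r), lam, he, ⟨fun r s => ?_, fun r u => ?_⟩, fun r => ?_⟩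
  · simpa using! hb (Sum.inr r) (Sum.inr s)
  · have hu : metricForm gN (φ x) (mfderiv (𝓡 n) (𝓡 (n + p)) φ x u) (b (Sum.inr r)) = 0 := by
      rw [← hB.sum_smul he hcard u]
      simp only [map_sum, map_smul, LinearMap.sum_apply, LinearMap.smul_apply, ← hbl, hb]
      simp
    exact hu
  · ext i j
    refine (h.inner_shapeOperator x (b (Sum.inr r)) (e j) (e i)).trans ?_
    rw [hmodel, map_smul, LinearMap.smul_apply, hηξ, ← hea, he, he, he]
    by_cases h0 : (r : ℕ) = 0
    · simp only [h0, if_true, Matrix.diagonal_apply, Fin.ext_iff, smul_eq_mul]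
      split_ifs <;> first | omega | ring
    · simp [h0]

end Equality

/-! ### Scalar curvature, the supremum, and the inequality. -/

section Inequality

theorem card_frame_top {n : ℕ} {M : Type*} [TopologicalSpace M]
    [ChartedSpace (EuclideanSpace ℝ (Fin n)) M] (x : M) :
    Fintype.card (Fin (Module.finrank ℝ (⊤ : Submodule ℝ (TangentSpace (𝓡 n) x)))) = n := by
  rw [Fintype.card_fin, finrank_top, finrank_tangentSpace]

variable {n d : ℕ}
  {M : Type*} [TopologicalSpace M] [ChartedSpace (EuclideanSpace ℝ (Fin n)) M]
  [IsManifold (𝓡 n) ∞ M]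
  {N : Type*} [TopologicalSpace N] [ChartedSpace (EuclideanSpace ℝ (Fin d)) N]
  [IsManifold (𝓡 d) ∞ N] {g : Metric n M} {gN : Metric d N} {φ : M → N}

theorem frame_isOrthonormal (g : Metric n M) (x : M)
    (L : Submodule ℝ (TangentSpace (𝓡 n) x)) :
    IsOrthonormal (fun v w => metricForm g x v w) (frame g x L) :=
  (exists_frame g x L).choose_spec.1

theorem span_frame (g : Metric n M) (x : M) (L : Submodule ℝ (TangentSpace (𝓡 n) x)) :
    Submodule.span ℝ (Set.range (frame g x L)) = L :=
  (exists_frame g x L).choose_spec.2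

theorem casoratiOn_eq (x : M) (L : Submodule ℝ (TangentSpace (𝓡 n) x)) :
    casoratiOn g gN φ x L = (1 / (Module.finrank ℝ L : ℝ)) *
      sumSq (metricForm gN (φ x)) (secondFundForm gN φ x) (frame g x L) := rfl

theorem sum_ite_lt_eq {m : ℕ} (a : Fin m → Fin m → ℝ) (ha : ∀ i j, a i j = a j i) :
    2 * ∑ i, ∑ j, (if i < j then a i j else 0) = ∑ i, ∑ j, a i j - ∑ i, a i i := by
  have h1 : ∑ i, ∑ j, (if i < j then a i j else 0) = ∑ i, ∑ j, (if j < i then a i j else 0) := by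
    rw [Finset.sum_comm]
    refine Finset.sum_congr rfl fun i _ => Finset.sum_congr rfl fun j _ => ?_
    rw [ha]
  have h2 : ∑ i, a i i = ∑ i, ∑ j, (if i = j then a i j else 0) := by simp
  rw [two_mul]
  nth_rewrite 2 [h1]
  rw [h2, ← Finset.sum_add_distrib, ← Finset.sum_sub_distrib]
  refine Finset.sum_congr rfl fun i _ => ?_
  rw [← Finset.sum_add_distrib, ← Finset.sum_sub_distrib]
  refine Finset.sum_congr rfl fun j _ => ?_
  rcases lt_trichotomy i j with hij | hij | hij
  · simp [hij, hij.not_gt, hij.ne]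
  · simp [hij]
  · simp [hij, hij.not_gt, hij.ne']

/-- Scalar curvature of a submanifold of a space form. -/
theorem IsIsometricImmersion.two_mul_scalarCurvature (h : IsIsometricImmersion g gN φ) {c : ℝ}
    (hN : IsRealSpaceForm gN c) (x : M) :
    2 * scalarCurvature g x = n * (n - 1) * c +
      metricForm gN (φ x) (∑ i, secondFundForm gN φ x (frame g x ⊤ i) (frame g x ⊤ i))
        (∑ i, secondFundForm gN φ x (frame g x ⊤ i) (frame g x ⊤ i)) -
      sumSq (metricForm gN (φ x)) (secondFundForm gN φ x) (frame g x ⊤) := by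
  set e := frame g x ⊤ with hedef
  have he : ∀ i j, metricForm g x (e i) (e j) = if i = j then 1 else 0 :=
    frame_isOrthonormal g x ⊤
  have hcard := card_frame_top (n := n) x
  have hH := isInnerForm_metricForm gN (φ x)
  -- The Gauss expression extended to all i, j. Its diagonal entries reduce to c, so summing over i
  -- < j twice produces n²c - nc.
  let a := fun i j => c +
      metricForm gN (φ x) (secondFundForm gN φ x (e i) (e i)) (secondFundForm gN φ x (e j) (e j)) -
      metricForm gN (φ x) (secondFundForm gN φ x (e i) (e j)) (secondFundForm gN φ x (e i) (e j))
  have h1 : scalarCurvature g x = ∑ i, ∑ j, if i < j then a i j else 0 := by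
    unfold scalarCurvature
    refine Finset.sum_congr rfl fun i _ => Finset.sum_congr rfl fun j _ => ?_
    split_ifs with hij
    · exact h.sectionalCurvature_eq hN x _ _ (by simp [← hedef, he]) (by simp [← hedef, he])
        (by simp [← hedef, he, hij.ne])
    · rfl
  rw [h1, sum_ite_lt_eq a fun i j => by
    simp only [a]; rw [hH.symm, h.secondFundForm_symm x (e i) (e j)]]
  simp only [a, Finset.sum_sub_distrib, Finset.sum_add_distrib, Finset.sum_const,
    Finset.card_univ, hcard, nsmul_eq_mul, sumSq, map_sum, LinearMap.sum_apply]
  rw [Finset.sum_comm]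
  ring

/-- The supremum in the normalized Casorati curvature is attained, and it is the maximal squared
norm of the restriction of the second fundamental form to hyperplanes. -/
theorem IsIsometricImmersion.exists_deltaHat_eq (h : IsIsometricImmersion g gN φ) (hn : 2 ≤ n)
    (x : M) : ∃ ν, metricForm g x ν ν = 1 ∧
      (∀ ν', metricForm g x ν' ν' = 1 →
        hyperplaneSq (metricForm gN (φ x)) (secondFundForm gN φ x) (frame g x ⊤) ν' ≤
        hyperplaneSq (metricForm gN (φ x)) (secondFundForm gN φ x) (frame g x ⊤) ν) ∧
      deltaHat g gN φ x =
        2 * (1 / n * sumSq (metricForm gN (φ x)) (secondFundForm gN φ x) (frame g x ⊤)) -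
        (2 * n - 1) / (2 * n) * (1 / (n - 1) *
          hyperplaneSq (metricForm gN (φ x)) (secondFundForm gN φ x) (frame g x ⊤) ν) := by
  have hB := isInnerForm_metricForm g x
  have hH := isInnerForm_metricForm gN (φ x)
  have hfin := finrank_tangentSpace (n := n) x
  have hcard := card_frame_top (n := n) x
  have : Nontrivial (TangentSpace (𝓡 n) x) :=
    Module.nontrivial_of_finrank_pos (R := ℝ) (by omega)
  obtain ⟨ν, hν, hmax⟩ := hB.exists_hyperplaneSq_max (h := secondFundForm gN φ x) hH (frame g x ⊤)
  refine ⟨ν, hν, hmax, ?_⟩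
  -- The normal ν completes the chosen frame of L to an orthonormal basis, and dim L = n - 1
  -- supplies the factor in C(L).
  have hsection : ∀ (L : Submodule ℝ (TangentSpace (𝓡 n) x)) (ν : TangentSpace (𝓡 n) x),
      Module.finrank ℝ L + 1 = n → metricForm g x ν ν = 1 →
      (∀ i, metricForm g x (frame g x L i) ν = 0) →
      casoratiOn g gN φ x L = 1 / (n - 1) *
        hyperplaneSq (metricForm gN (φ x)) (secondFundForm gN φ x) (frame g x ⊤) ν := by
    intro L ν hL hν hLν
    let b : Option (Fin (Module.finrank ℝ L)) → TangentSpace (𝓡 n) x :=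
      fun o => o.elim ν (frame g x L)
    have hb : IsOrthonormal (fun v w => metricForm g x v w) b := by
      rintro (_ | i) (_ | j)
      · simpa [b] using hν
      · simpa [b] using (hB.symm _ _).trans (hLν j)
      · simpa [b] using hLν i
      · simpa [b] using frame_isOrthonormal g x L i j
    have := hB.sumSq_some_eq (H := metricForm gN (φ x)) (h.secondFundForm_symm x)
      (frame_isOrthonormal g x ⊤) (hfin.trans hcard.symm) hb (by simp [hfin, hL])
    rw [casoratiOn_eq]
    have hc : (Module.finrank ℝ L : ℝ) = n - 1 := by
      have : ((Module.finrank ℝ L + 1 : ℕ) : ℝ) = n := congrArg _ hL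
      push_cast at this
      linarith
    rw [hc]
    exact congrArg _ this
  -- Unit normals and hyperplanes correspond: the maximizing ν gives an L attaining the value, and
  -- each L has a unit normal whose value is bounded by the maximum. Thus `sSup` is a true maximum
  -- rather than its default value.
  have hgreatest : IsGreatest {C : ℝ | ∃ L : Submodule ℝ (TangentSpace (𝓡 n) x),
      Module.finrank ℝ L + 1 = n ∧ C = casoratiOn g gN φ x L} (1 / (n - 1) *
        hyperplaneSq (metricForm gN (φ x)) (secondFundForm gN φ x) (frame g x ⊤) ν) := by
    constructor
    · obtain ⟨k, rfl⟩ : ∃ k, n = k + 1 := ⟨n - 1, by omega⟩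
      obtain ⟨b, hb, hbν⟩ := hB.exists_isOrthonormal_extension (ι := Option (Fin k))
        (by simp [hfin]) (fun _ => ν) {none} (by simp [hν])
      have hbν : b none = ν := hbν none rfl
      have hli := (hB.linearIndependent hb).comp some (Option.some_injective _)
      have hL : Module.finrank ℝ (Submodule.span ℝ (Set.range (b ∘ some))) + 1 = k + 1 := by
        rw [finrank_span_eq_card hli, Fintype.card_fin]
      refine ⟨_, hL, (hsection _ ν hL hν fun i => ?_).symm⟩
      have hle : Submodule.span ℝ (Set.range (b ∘ some)) ≤
          LinearMap.ker ((metricForm g x).flip ν) := by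
        rw [Submodule.span_le]
        rintro _ ⟨j, rfl⟩
        have := hb (some j) none
        simpa [hbν] using this
      have hi : frame g x (Submodule.span ℝ (Set.range (b ∘ some))) i ∈
          Submodule.span ℝ (Set.range (b ∘ some)) :=
        (span_frame g x _).le (Submodule.subset_span ⟨i, rfl⟩)
      exact hle hi
    · rintro _ ⟨L, hL, rfl⟩
      obtain ⟨b, hb, hbL⟩ := hB.exists_isOrthonormal_extension
        (ι := Option (Fin (Module.finrank ℝ L))) (by simp [hfin, hL])
        (fun o => o.elim 0 (frame g x L)) (Set.range some) (by
          rintro _ ⟨i, rfl⟩ _ ⟨j, rfl⟩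
          simpa using frame_isOrthonormal g x L i j)
      have hν' : metricForm g x (b none) (b none) = 1 := by simpa using hb none none
      rw [hsection L (b none) hL hν' fun i => by
        have := hb (some i) none
        rw [hbL (some i) ⟨i, rfl⟩] at this
        simpa using this]
      have hn1 : (0 : ℝ) ≤ 1 / ((n : ℝ) - 1) := by
        have : (2 : ℝ) ≤ n := by exact_mod_cast hn
        apply one_div_nonneg.2; linarith
      exact mul_le_mul_of_nonneg_left (hmax _ hν') hn1
  have htop : (Module.finrank ℝ (⊤ : Submodule ℝ (TangentSpace (𝓡 n) x)) : ℝ) = n := by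
    rw [finrank_top, hfin]
  rw [deltaHat, hgreatest.csSup_eq, casorati, casoratiOn_eq, htop]

theorem IsIsometricImmersion.normalizedScalarCurvature_le (h : IsIsometricImmersion g gN φ)
    (hn : 2 ≤ n) {c : ℝ} (hN : IsRealSpaceForm gN c) (x : M) :
    normalizedScalarCurvature g x ≤ deltaHat g gN φ x + c ∧
    (normalizedScalarCurvature g x = deltaHat g gN φ x + c ↔ IsIdealForm g gN φ x) := by
  have hB := isInnerForm_metricForm g x
  have hH := isInnerForm_metricForm gN (φ x)
  have hfin := finrank_tangentSpace (n := n) x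
  have hcard := card_frame_top (n := n) x
  obtain ⟨ν, hν, hmax, hδ⟩ := h.exists_deltaHat_eq hn x
  have hτ := h.two_mul_scalarCurvature hN x
  have hn2 : (2 : ℝ) ≤ n := by exact_mod_cast hn
  have hpos : (0 : ℝ) < n * (n - 1) := mul_pos (by linarith) (by linarith)
  set T := ∑ i, secondFundForm gN φ x (frame g x ⊤ i) (frame g x ⊤ i) with hT
  set S := sumSq (metricForm gN (φ x)) (secondFundForm gN φ x) (frame g x ⊤) with hS
  -- The coefficient of S is 2/n + 1/(n(n-1)) = (2n-1)/(n(n-1)), the same 2n-1 as in the algebraic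
  -- inequality.
  have key : deltaHat g gN φ x + c - normalizedScalarCurvature g x =
      ((2 * n - 1) * (S - hyperplaneSq (metricForm gN (φ x)) (secondFundForm gN φ x)
        (frame g x ⊤) ν / 2) - metricForm gN (φ x) T T) / (n * (n - 1)) := by
    rw [hδ, normalizedScalarCurvature, hτ]
    have h1 : (n : ℝ) ≠ 0 := by linarith
    have h2 : (n : ℝ) - 1 ≠ 0 := by linarith
    field_simp
    ring
  have hmain := hB.trace_sq_le hH (h.secondFundForm_symm x) hfin (frame_isOrthonormal g x ⊤)
    hcard hν
  refine ⟨?_, fun heq => ?_, ?_⟩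
  · have : 0 ≤ deltaHat g gN φ x + c - normalizedScalarCurvature g x := by
      rw [key]; exact div_nonneg (sub_nonneg.2 hmain.1) hpos.le
    linarith
  · rw [heq, sub_self, eq_comm, div_eq_zero_iff] at key
    exact ⟨ν, _, hν, hmain.2 (sub_eq_zero.1 (key.resolve_right hpos.ne')).symm⟩
  · rintro ⟨a, η, ha, hmodel⟩
    obtain ⟨hle, heq⟩ := hB.trace_sq_eq_of_quasiUmbilical hH hfin (frame_isOrthonormal g x ⊤)
      hcard ha hmodel
    -- The maximizer ν need not be ±a (for instance if η = 0), but both maximize, so the values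
    -- coincide.
    have hQ := le_antisymm (hle ν hν) (hmax a ha)
    rw [hQ, ← heq, sub_self, zero_div] at key
    linarith

end Inequality

end Casorati

end

theorem theorem1p1 (n p : ℕ) (hn : 2 ≤ n) (c : ℝ)
    {M : Type*} [TopologicalSpace M] [ChartedSpace (EuclideanSpace ℝ (Fin n)) M]
    [IsManifold (𝓡 n) ∞ M]
    {N : Type*} [TopologicalSpace N] [ChartedSpace (EuclideanSpace ℝ (Fin (n + p))) N]
    [IsManifold (𝓡 (n + p)) ∞ N]
    (g : Casorati.Metric n M) (gN : Casorati.Metric (n + p) N)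
    (hN : Casorati.IsRealSpaceForm gN c)
    (φ : M → N) (hφ : Casorati.IsIsometricImmersion g gN φ) :
    (∀ x : M, Casorati.normalizedScalarCurvature g x ≤ Casorati.deltaHat g gN φ x + c) ∧
    (∀ x : M, Casorati.normalizedScalarCurvature g x = Casorati.deltaHat g gN φ x + c ↔
      Casorati.InvariantlyQuasiUmbilicalAt p g gN φ x ∧
      Casorati.NormalFlatAt (n := n) gN φ x ∧
      Casorati.IdealShapeAt p g gN φ x) ∧
    ((∀ x : M, Casorati.normalizedScalarCurvature g x = Casorati.deltaHat g gN φ x + c) ↔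
      Casorati.InvariantlyQuasiUmbilical p g gN φ ∧
      Casorati.TrivialNormalConnection (n := n) gN φ ∧
      ∀ x : M, Casorati.IdealShapeAt p g gN φ x) := by
  have hpt : ∀ x : M,
      Casorati.normalizedScalarCurvature g x = Casorati.deltaHat g gN φ x + c ↔
      Casorati.InvariantlyQuasiUmbilicalAt p g gN φ x ∧
      Casorati.NormalFlatAt (n := n) gN φ x ∧
      Casorati.IdealShapeAt p g gN φ x := by
    intro x
    rw [(hφ.normalizedScalarCurvature_le hn hN x).2]
    constructor
    · intro hx
      have hshape := hφ.idealShapeAt_of_isIdealForm (by omega) hx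
      obtain ⟨e, ξ, lam, he, hξ, hA⟩ := hshape
      exact ⟨hφ.invariantlyQuasiUmbilicalAt_of_idealForm hx hξ,
        hφ.normalFlatAt_of_idealForm hN hx, e, ξ, lam, he, hξ, hA⟩
    -- The matrices in (iii) determine h completely, and hence equality.
    · rintro ⟨-, -, hshape⟩
      exact hφ.isIdealForm_of_idealShapeAt (by omega) hshape
  refine ⟨fun x => (hφ.normalizedScalarCurvature_le hn hN x).1, hpt, ?_⟩
  -- The global conditions are by definition the pointwise ones at every x.
  simp only [hpt, forall_and]
  rfl
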